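/- **Conventions.** $X$ is a finite pure $n$-dimensional simplicial complex (every simplex is contained in an $n$-simplex, and there is at least one $n$-simplex); $X^{(k)}$ is its set of $k$-simplices, with $X^{(-1)}=\{\emptyset\}$. A *weight function* on $X$ is a strictly positive function $m$ on $\bigcup_{k=-1}^{n}X^{(k)}$ such that $m(\tau)=\sum_{\sigma\in X^{(k+1)},\,\tau\subset\sigma}m(\sigma)$ for all $\tau\in X^{(k)}$, $-1\le k\le n-1$ (for example the homogeneous weight $m(\tau)=(n-k)!\,|\{\sigma\in X^{(n)}:\tau\subseteq\sigma\}|$ for $\tau\in X^{(k)}$). The link $X_\tau$ of $\tau\in X^{(k)}$ consists of the simplices $\sigma$ disjoint from $\tau$ with $\tau\cup\sigma$ a simplex of $X$ (so $X_\emptyset=X$ and $\dim X_\tau=n-k-1$); it carries the weight $m_\tau(\sigma)=m(\tau\cup\sigma)$. On functions $\phi:X_\tau^{(0)}\to\mathbb R$ the upper Laplacian is $\Delta^+_{\tau,0}=\delta d$, where $d\phi(u,v)=\phi(v)-\phi(u)$ and $\delta$ is the adjoint of $d$ for the $m_\tau$-weighted inner products, i.e. $\Delta^+_{\tau,0}\phi(u)=\sum_{v:\{u,v\}\in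 X_\tau^{(1)}}\frac{m_\tau(\{u,v\})}{m_\tau(\{u\})}(\phi(u)-\phi(v))$. For $n \ge 1$ we say that $(X,m)$ has *(one-sided) $\lambda$-local spectral expansion* if $\lambda>\frac{n-1}{n}$, all links of $X$ of dimension $>0$ (including $X$ itself) are connected, and $\mathrm{Spec}(\Delta^+_{\tau,0})\setminus\{0\}\subseteq[\lambda,\infty)$ for every $\tau\in X^{(n-2)}$. $X$ is *$(n+1)$-partite* with sides $S_0,\dots,S_n$ if these sets partition $X^{(0)}$ and the two vertices of every edge lie in different sides. For $U\subseteq X^{(0)}$ put $m(U)=\sum_{u\in U}m(\{u\})$, and for pairwise disjoint $U_0,\dots,U_l \subseteq X^{(0)}$ put $$m(U_0,\dots,U_l)=\sum_{\{u_0,\dots,u_l\}\in X^{(l)},\ u_0\in U_0,\dots,u_l\in U_l}m(\{u_0,\dots,u_l\}).$$ **Theorem.** Let $1\le l\le n$. There is a continuous function $\mathcal E_l:(\frac{n-1}{n},\infty)\to\mathbb R$, depending only on $n$ and $l$, with $\lim_{\lambda\to1}\mathcal E_l(\lambda)=0$, such that for every finite pure $n$-dimensional $(n+1)$-partite simplicial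 complex $X$ with sides $S_0,\dots,S_n$ and weight function $m$ that has $\lambda$-local spectral expansion, and for all non-empty sets $U_0\subseteq S_0,\dots,U_l\subseteq S_l$, $$\left|\frac{m(U_0,\dots,U_l)}{m(X^{(0)})}-\frac{1}{(n+1)n(n-1)\cdots(n-l+1)}\,\frac{m(U_0)\cdots m(U_l)}{m(S_0)\cdots m(S_l)}\right|\le\mathcal E_l(\lambda)\min_{0\le i<j\le l}\sqrt{\frac{m(U_i)m(U_j)}{m(S_i)m(S_j)}}$$ and $$\left|\frac{m(U_0,\dots,U_l)}{m(X^{(0)})}-\frac{1}{(n+1)n(n-1)\cdots(n-l+1)}\,\frac{m(U_0)\cdots m(U_l)}{m(S_0)\cdots m(S_l)}\right|\le\mathcal E_l(\lambda)\left(\frac{m(U_0)\cdots m(U_l)}{m(S_0)\cdots m(S_l)}\right)^{\frac1{l+1}}.$$ -/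

import Mathlib

open Filter Topology

noncomputable section

namespace PreAbstractSimplicialComplex

variable {V : Type*}

/-! A finite simplicial complex is a `PreAbstractSimplicialComplex V` over a finite type `V`. Its
members are the non-empty simplices; a `k`-simplex is a member with `k + 1` elements, and the empty
set plays the role of the only `(-1)`-simplex. Elements `v : V` with `{v} ∉ X` are not vertices. -/

/-- `τ` is a simplex of `X` of some dimension `≥ -1`. -/
def IsSimplex (X : PreAbstractSimplicialComplex V) (τ : Finset V) : Prop :=
  τ = ∅ ∨ τ ∈ X

/-- `X` is pure `n`-dimensional: every simplex (the empty one included, so that `X` has at least one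
`n`-simplex) is a face of an `n`-simplex. -/
def IsPure (X : PreAbstractSimplicialComplex V) (n : ℕ) : Prop :=
  ∀ τ, X.IsSimplex τ → ∃ σ ∈ X, τ ⊆ σ ∧ σ.card = n + 1

/-- The type of vertices of `X`. -/
abbrev Vert (X : PreAbstractSimplicialComplex V) : Type _ := {v : V // {v} ∈ X}

open Classical in
/-- The vertex set `X⁽⁰⁾` as a finite subset of `V`. -/
def vertexFinset [Fintype V] (X : PreAbstractSimplicialComplex V) : Finset V :=
  Finset.univ.filter fun v => {v} ∈ X

/-- The graph of vertices and edges of `X`. -/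
def oneSkeleton [DecidableEq V] (X : PreAbstractSimplicialComplex V) : SimpleGraph X.Vert where
  Adj u v := u ≠ v ∧ {u.1, v.1} ∈ X
  symm := ⟨fun u v h => ⟨h.1.symm, by rw [Finset.pair_comm]; exact h.2⟩⟩
  loopless := ⟨fun _ h => h.1 rfl⟩

/-- The link of `τ`: the non-empty `σ` disjoint from `τ` with `τ ∪ σ` a simplex. The link of `∅` is
`X` itself. -/
def link [DecidableEq V] (X : PreAbstractSimplicialComplex V) (τ : Finset V) :
    PreAbstractSimplicialComplex V where
  faces := {σ | σ.Nonempty ∧ Disjoint τ σ ∧ τ ∪ σ ∈ X}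
  isRelLowerSet_faces := by
    rintro σ ⟨h1, h2, h3⟩
    refine ⟨h1, fun ρ hρ hne => ⟨hne, h2.mono_right hρ, ?_⟩⟩
    exact (X.isRelLowerSet_faces h3).2 (Finset.union_subset_union_right hρ)
      (hne.mono Finset.subset_union_right)

/-- All links of dimension `> 0` of the pure `n`-dimensional complex `X`, including `X` itself, are
connected; the link of a simplex with `t` elements has dimension `n - t`. -/
def LinksConnected [DecidableEq V] (X : PreAbstractSimplicialComplex V) (n : ℕ) : Prop :=
  ∀ τ, X.IsSimplex τ → τ.card < n → (X.link τ).oneSkeleton.Connected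

open Classical in
/-- `m` is a weight function on `X`: it is positive on all simplices of dimension `-1, …, n`, and the
weight of a simplex of dimension `< n` is the sum of the weights of the simplices of the next
dimension that contain it. Values of `m` off the simplices of `X` are irrelevant. -/
structure IsWeight [Fintype V] (X : PreAbstractSimplicialComplex V) (n : ℕ)
    (m : Finset V → ℝ) : Prop where
  pos : ∀ τ, X.IsSimplex τ → 0 < m τ
  sum_eq : ∀ τ, X.IsSimplex τ → τ.card ≤ n →
    ∑ σ ∈ Finset.univ.filter (fun σ => σ ∈ X ∧ τ ⊆ σ ∧ σ.card = τ.card + 1), m σ = m τ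

/-- The weight function `m_τ (σ) = m (τ ∪ σ)` on the link of `τ`. -/
def linkWeight [DecidableEq V] (m : Finset V → ℝ) (τ : Finset V) : Finset V → ℝ :=
  fun σ => m (τ ∪ σ)

/-! ### The upper Laplacian on `0`-forms

A `0`-form is a function on the vertices. A `1`-form is written as a function of two vertices, of
which only the values on ordered edges matter. -/

/-- The differential `(d φ) (u, v) = φ v - φ u`. -/
def d0 (X : PreAbstractSimplicialComplex V) :
    (X.Vert → ℝ) →ₗ[ℝ] (X.Vert → X.Vert → ℝ) where
  toFun φ u v := φ v - φ u
  map_add' φ ψ := by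
    funext u v
    simp only [Pi.add_apply]
    ring
  map_smul' c φ := by
    funext u v
    simp only [Pi.smul_apply, smul_eq_mul, RingHom.id_apply]
    ring

open Classical in
/-- The adjoint `(δ ψ) (u) = ∑_{v : (v, u) an edge} m({v, u}) / m({u}) * ψ (v, u)` of `d0`, see
`inner_d0_eq_inner_delta0`. -/
def delta0 [Fintype V] [DecidableEq V] (X : PreAbstractSimplicialComplex V) (m : Finset V → ℝ) :
    (X.Vert → X.Vert → ℝ) →ₗ[ℝ] (X.Vert → ℝ) where
  toFun ψ u := ∑ v ∈ Finset.univ.filter (fun v => X.oneSkeleton.Adj v u),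
    m {v.1, u.1} / m {u.1} * ψ v u
  map_add' φ ψ := by
    funext u
    simp only [Pi.add_apply, mul_add, Finset.sum_add_distrib]
  map_smul' c φ := by
    funext u
    simp only [Pi.smul_apply, smul_eq_mul, RingHom.id_apply, Finset.mul_sum]
    exact Finset.sum_congr rfl fun v _ => by ring

/-- The upper Laplacian `Δ₀⁺ = δ₀ d₀` of the weighted complex `(X, m)`. -/
def upperLaplacian [Fintype V] [DecidableEq V] (X : PreAbstractSimplicialComplex V)
    (m : Finset V → ℝ) : Module.End ℝ (X.Vert → ℝ) :=
  X.delta0 m ∘ₗ X.d0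

open Classical in
/-- The inner product of `0`-forms. -/
def inner0 [Fintype V] (X : PreAbstractSimplicialComplex V) (m : Finset V → ℝ)
    (φ ψ : X.Vert → ℝ) : ℝ :=
  ∑ u, m {u.1} * (φ u * ψ u)

open Classical in
/-- The inner product of `1`-forms: the sum over ordered edges, with the factor `1 / 2!`. -/
def inner1 [Fintype V] [DecidableEq V] (X : PreAbstractSimplicialComplex V) (m : Finset V → ℝ)
    (φ ψ : X.Vert → X.Vert → ℝ) : ℝ :=
  ∑ u, ∑ v ∈ Finset.univ.filter (fun v => X.oneSkeleton.Adj v u),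
    m {v.1, u.1} / 2 * (φ v u * ψ v u)

/-- `delta0` is the adjoint of `d0` on antisymmetric `1`-forms. -/
theorem inner_d0_eq_inner_delta0 [Fintype V] [DecidableEq V] (X : PreAbstractSimplicialComplex V)
    (m : Finset V → ℝ) (hm : ∀ u : X.Vert, m {u.1} ≠ 0) (φ : X.Vert → ℝ)
    (ψ : X.Vert → X.Vert → ℝ) (hψ : ∀ u v, ψ u v = -ψ v u) :
    X.inner1 m (X.d0 φ) ψ = X.inner0 m φ (X.delta0 m ψ) := by
  classical
  have key : ∑ u : X.Vert, ∑ v : X.Vert, (if X.oneSkeleton.Adj v u then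
        m {v.1, u.1} / 2 * (φ v * ψ v u) else 0)
      = -∑ u : X.Vert, ∑ v : X.Vert, (if X.oneSkeleton.Adj v u then
        m {v.1, u.1} / 2 * (φ u * ψ v u) else 0) := by
    rw [Finset.sum_comm, ← Finset.sum_neg_distrib]
    refine Finset.sum_congr rfl fun u _ => ?_
    rw [← Finset.sum_neg_distrib]
    refine Finset.sum_congr rfl fun v _ => ?_
    rw [X.oneSkeleton.adj_comm u v, Finset.pair_comm u.1 v.1, hψ u v]
    split_ifs <;> ring
  have e1 : X.inner1 m (X.d0 φ) ψ
      = (∑ u : X.Vert, ∑ v : X.Vert, (if X.oneSkeleton.Adj v u then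
        m {v.1, u.1} / 2 * (φ u * ψ v u) else 0))
      - ∑ u : X.Vert, ∑ v : X.Vert, (if X.oneSkeleton.Adj v u then
        m {v.1, u.1} / 2 * (φ v * ψ v u) else 0) := by
    rw [← Finset.sum_sub_distrib]
    refine Finset.sum_congr (by ext; simp) fun u _ => ?_
    rw [← Finset.sum_sub_distrib, Finset.sum_filter]
    refine Finset.sum_congr (by ext; simp) fun v _ => ?_
    simp only [d0, LinearMap.coe_mk, AddHom.coe_mk]
    split_ifs <;> ring
  have e2 : X.inner0 m φ (X.delta0 m ψ)
      = 2 * ∑ u : X.Vert, ∑ v : X.Vert, (if X.oneSkeleton.Adj v u then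
        m {v.1, u.1} / 2 * (φ u * ψ v u) else 0) := by
    rw [Finset.mul_sum]
    refine Finset.sum_congr (by ext; simp) fun u _ => ?_
    simp only [delta0, LinearMap.coe_mk, AddHom.coe_mk]
    rw [Finset.mul_sum, Finset.mul_sum, Finset.mul_sum, Finset.sum_filter]
    refine Finset.sum_congr (by ext; simp) fun v _ => ?_
    have := hm u
    split_ifs
    · field_simp
    · ring
  rw [e1, e2, key]
  ring

/-- One-sided `lam`-local spectral expansion of the pure `n`-dimensional weighted complex `(X, m)`:
`lam > (n - 1) / n`, all links of dimension `> 0` (with `X` itself) are connected, and the non-zero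
spectrum of the upper Laplacian of every `1`-dimensional link (the link of an `(n - 2)`-simplex, that
is of a simplex with `n - 1` elements) lies in `[lam, ∞)`. -/
structure LocalSpectralExpansion [Fintype V] [DecidableEq V] (X : PreAbstractSimplicialComplex V)
    (n : ℕ) (m : Finset V → ℝ) (lam : ℝ) : Prop where
  lt_lam : ((n : ℝ) - 1) / n < lam
  linksConnected : X.LinksConnected n
  spectrum_subset : ∀ τ, X.IsSimplex τ → τ.card + 1 = n →
    spectrum ℝ ((X.link τ).upperLaplacian (linkWeight m τ)) \ {0} ⊆ Set.Ici lam

/-- `X` is `(n + 1)`-partite with sides `S 0, …, S n`: the sides partition the vertex set and the two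
ends of every edge lie in different sides. -/
structure IsPartite [DecidableEq V] (X : PreAbstractSimplicialComplex V) (n : ℕ)
    (S : Fin (n + 1) → Finset V) : Prop where
  disjoint : ∀ i j, i ≠ j → Disjoint (S i) (S j)
  cover : ∀ v, {v} ∈ X ↔ ∃ i, v ∈ S i
  edge : ∀ u v, u ≠ v → {u, v} ∈ X → ∃ i j, i ≠ j ∧ u ∈ S i ∧ v ∈ S j

/-- The weight `m(U) = ∑_{u ∈ U} m({u})` of a set of vertices. -/
def setWeight (m : Finset V → ℝ) (U : Finset V) : ℝ :=
  ∑ u ∈ U, m {u}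

open Classical in
/-- `m(U_0, …, U_l)`: the sum of `m` over the `l`-simplices `{u_0, …, u_l}` of `X` with
`u_i ∈ U_i`. -/
def mixedWeight [Fintype V] (X : PreAbstractSimplicialComplex V) (m : Finset V → ℝ) {l : ℕ}
    (U : Fin (l + 1) → Finset V) : ℝ :=
  ∑ σ ∈ Finset.univ.filter (fun σ : Finset V => σ ∈ X ∧ σ.card = l + 1 ∧
    ∃ u : Fin (l + 1) → V, (∀ i, u i ∈ U i) ∧ σ = Finset.univ.image u), m σ

end PreAbstractSimplicialComplex

end

open PreAbstractSimplicialComplex (setWeight)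

/-! The weight `m` is extended by zero to a function `F` on all finite sets of vertices, and
everything is phrased through `flagSum`, the weighted sum over ordered tuples of new vertices, which
is symmetric in its list of functions.

Spectral input. A gap `lam` in the one-dimensional links trickles down: a connected complex whose
vertex links have gap `lam` has gap `2 - 1 / lam` (`hasGap_trickle_down`). With `ε = 1 - lam`,
iteration gives `1 - ε / (1 - t * ε)`, which stays under control because `n * ε < 1`. Edges join
only different sides, so the gap inequality for `f + k`, with `f` and `k` of mean zero on two
different sides, bounds their correlation (`two_mul_flagSum_pair_le`). The sign of `f` is free,
which is why a one-sided gap suffices.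

Mixing. A mean-zero function on one side is nearly uncorrelated with a product of functions on
several other sides (`two_mul_flagSum_cons_le`). The proof conditions on a vertex `a` of another
side. The part of the function with mean zero in the link of `a` is treated by induction, and its
conditional mean is a two-sided correlation. Indicators are then replaced one by one by their
densities `p i`. The sides share the weight of a face equally (`side_weight_eq`), so the main term
is exactly the product of the densities divided by the falling factorial.

By symmetry any two sides can be replaced first, which bounds the error by a multiple of `√(p i * p
j)` for every pair. Multiplying these bounds around a cycle of indices gives the geometric mean. -/

/-! ### Weighted graphs: eigenvalues, Poincaré inequality, trickling down. -/

/-- A matrix which is symmetric, supported on the support of the weight `w`, and not positive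
semidefinite has a negative eigenvalue relative to `w`. -/
theorem exists_neg_weighted_eigenvector {V : Type*} [Fintype V] [DecidableEq V]
    (C : V → V → ℝ) (w : V → ℝ) (hC : ∀ u v, C u v = C v u) (hw : ∀ u, 0 ≤ w u)
    (hCw : ∀ u, w u = 0 → ∀ v, C u v = 0) (φ : V → ℝ)
    (hφ : ∑ u, ∑ v, C u v * φ u * φ v < 0) :
    ∃ c < 0, ∃ ψ : V → ℝ, (∀ u, ∑ v, C u v * ψ v = c * (w u * ψ u)) ∧
      0 < ∑ u, w u * ψ u ^ 2 := by
  set s : V → ℝ := fun u => √(w u) with hs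
  have hs2 : ∀ u, s u * s u = w u := fun u => Real.mul_self_sqrt (hw u)
  have hs0 : ∀ u, s u = 0 → w u = 0 := fun u h => by rw [← hs2, h, mul_zero]
  -- Conjugation by `w ^ (-1/2)` turns the relative eigenvalue problem into an ordinary symmetric
  -- one. Where `w` vanishes, the convention `0⁻¹ = 0` kills the row and column, and `hCw` says that
  -- nothing is lost.
  set B : Matrix V V ℝ := Matrix.of fun u v => (s u)⁻¹ * C u v * (s v)⁻¹ with hB
  have hBapp : ∀ u v, B u v = (s u)⁻¹ * C u v * (s v)⁻¹ := fun u v => rfl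
  have hCB : ∀ u v, C u v = s u * B u v * s v := by
    intro u v
    rw [hBapp]
    by_cases hu : s u = 0
    · rw [hCw u (hs0 u hu), hu]; ring
    by_cases hv : s v = 0
    · rw [hC u v, hCw v (hs0 v hv), hv]; ring
    field_simp
  have hBH : B.IsHermitian := by
    ext u v
    simp only [Matrix.conjTranspose_apply, star_trivial, hBapp, hC u v]
    ring
  have hnot : ¬ ∀ i, 0 ≤ hBH.eigenvalues i := by
    intro h
    have hpsd : B.PosSemidef := hBH.posSemidef_iff_eigenvalues_nonneg.2 h
    have := hpsd.dotProduct_mulVec_nonneg (fun u => s u * φ u)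
    refine absurd this (not_le.2 (lt_of_eq_of_lt ?_ hφ))
    simp only [dotProduct, Matrix.mulVec, Pi.star_apply, star_trivial, Finset.mul_sum]
    refine Finset.sum_congr rfl fun u _ => Finset.sum_congr rfl fun v _ => ?_
    rw [hCB u v]; ring
  push Not at hnot
  obtain ⟨i, hi⟩ := hnot
  set y : V → ℝ := ⇑(hBH.eigenvectorBasis i) with hy
  have hBy : ∀ u, ∑ v, B u v * y v = hBH.eigenvalues i * y u := fun u => by
    have := congrFun (hBH.mulVec_eigenvectorBasis i) u
    simpa [Matrix.mulVec, dotProduct] using this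
  -- The eigenvalue is non-zero, so an eigenvector vanishes on the zero rows of `B`.
  have hy0 : ∀ u, s u = 0 → y u = 0 := by
    intro u hu
    have := hBy u
    simp only [hBapp, hu, inv_zero, zero_mul, Finset.sum_const_zero] at this
    rcases mul_eq_zero.1 this.symm with h | h
    · exact absurd h hi.ne
    · exact h
  refine ⟨hBH.eigenvalues i, hi, fun u => (s u)⁻¹ * y u, fun u => ?_, ?_⟩
  · have h1 : ∑ v, C u v * ((s v)⁻¹ * y v) = s u * ∑ v, B u v * y v := by
      rw [Finset.mul_sum]
      refine Finset.sum_congr rfl fun v _ => ?_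
      rw [hCB u v]
      by_cases hv : s v = 0
      · rw [hy0 v hv]; ring
      · field_simp
    rw [h1, hBy, ← hs2]
    by_cases hu : s u = 0
    · rw [hu]; ring
    · field_simp
  · have h1 : ∑ u, w u * ((s u)⁻¹ * y u) ^ 2 = ∑ u, y u ^ 2 := by
      refine Finset.sum_congr rfl fun u _ => ?_
      rw [← hs2]
      by_cases hu : s u = 0
      · rw [hy0 u hu]; ring
      · field_simp
    rw [h1]
    have h2 : y ≠ 0 := by
      intro h
      have := hBH.eigenvectorBasis.orthonormal.ne_zero i
      exact this (by ext u; exact congrFun h u)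
    obtain ⟨u, hu⟩ := Function.ne_iff.1 h2
    exact Finset.sum_pos' (fun u _ => sq_nonneg _) ⟨u, Finset.mem_univ u, sq_pos_iff.2 hu⟩

/-- The Poincaré inequality with constant `lam` for the weighted graph with edge weights `K`. -/
def HasGap {V : Type*} [Fintype V] (K : V → V → ℝ) (lam : ℝ) : Prop :=
  ∀ φ : V → ℝ,
    lam * (∑ u, (∑ v, K u v) * φ u ^ 2 - (∑ u, (∑ v, K u v) * φ u) ^ 2 / ∑ u, ∑ v, K u v)
      ≤ ∑ u, (∑ v, K u v) * φ u ^ 2 - ∑ u, ∑ v, K u v * φ u * φ v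

/-- A function that is constant along the edges of `K` is constant on the vertices. -/
def EdgeConnected {V : Type*} [Fintype V] (K : V → V → ℝ) : Prop :=
  ∀ φ : V → ℝ, (∀ u v, 0 < K u v → φ u = φ v) →
    ∀ u v, 0 < ∑ a, K u a → 0 < ∑ a, K v a → φ u = φ v

theorem sum_mul_sq_sub_sq {V : Type*} [Fintype V] (K : V → V → ℝ) (hK : ∀ u v, K u v = K v u)
    (φ : V → ℝ) :
    ∑ u, ∑ v, K u v * (φ u - φ v) ^ 2
      = 2 * (∑ u, (∑ v, K u v) * φ u ^ 2 - ∑ u, ∑ v, K u v * φ u * φ v) := by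
  have h1 : ∑ u, ∑ v, K u v * φ v ^ 2 = ∑ u, ∑ v, K u v * φ u ^ 2 := by
    rw [Finset.sum_comm]
    exact Finset.sum_congr rfl fun u _ => Finset.sum_congr rfl fun v _ => by rw [hK]
  have h2 : ∑ u, ∑ v, K u v * (φ u - φ v) ^ 2 = ∑ u, ∑ v, K u v * φ u ^ 2
      + ∑ u, ∑ v, K u v * φ v ^ 2 - 2 * ∑ u, ∑ v, K u v * φ u * φ v := by
    simp only [Finset.mul_sum, ← Finset.sum_add_distrib, ← Finset.sum_sub_distrib]
    exact Finset.sum_congr rfl fun u _ => Finset.sum_congr rfl fun v _ => by ring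
  rw [h2, h1]
  simp only [Finset.sum_mul]
  ring

/-- If all non-zero eigenvalues of the Laplacian of a connected weighted graph are at least `lam`,
then the Poincaré inequality holds with constant `lam`. -/
theorem hasGap_of_eigenvalues {V : Type*} [Fintype V] [DecidableEq V] (K : V → V → ℝ)
    (hK : ∀ u v, K u v = K v u) (hK0 : ∀ u v, 0 ≤ K u v) (hconn : EdgeConnected K) (lam : ℝ)
    (h : ∀ (μ : ℝ) (ψ : V → ℝ), μ ≠ 0 →
      (∀ u, (∑ v, K u v) * ψ u - ∑ v, K u v * ψ v = μ * ((∑ v, K u v) * ψ u)) →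
      0 < ∑ u, (∑ v, K u v) * ψ u ^ 2 → lam ≤ μ) : HasGap K lam := by
  intro φ
  set w : V → ℝ := fun u => ∑ v, K u v with hwdef
  have hw0 : ∀ u, 0 ≤ w u := fun u => Finset.sum_nonneg fun v _ => hK0 u v
  set M : ℝ := ∑ u, w u with hM
  by_contra hcon
  have hKw : ∀ u, w u = 0 → ∀ v, K u v = 0 := fun u hu v =>
    (Finset.sum_eq_zero_iff_of_nonneg fun v _ => hK0 u v).1 hu v (Finset.mem_univ v)
  -- The quadratic form of `C` is the Dirichlet form minus `lam` times the variance, so failure of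
  -- the Poincaré inequality means that `C` is not positive semidefinite.
  set C : V → V → ℝ := fun u v =>
    (if u = v then w u else 0) - K u v - lam * ((if u = v then w u else 0) - w u * w v / M) with hC
  have hCmul : ∀ ψ : V → ℝ, ∀ u, ∑ v, C u v * ψ v
      = w u * ψ u - ∑ v, K u v * ψ v - lam * (w u * ψ u - w u * (∑ v, w v * ψ v) / M) := by
    intro ψ u
    have : ∀ v, C u v * ψ v = (if u = v then w u * ψ v else 0) - K u v * ψ v
        - lam * ((if u = v then w u * ψ v else 0) - w u * (w v * ψ v) / M) := by
      intro v
      simp only [hC]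
      split_ifs <;> ring
    simp only [this, Finset.sum_sub_distrib, ← Finset.mul_sum, Finset.sum_ite_eq, Finset.mem_univ,
      if_true, ← Finset.sum_div]
  obtain ⟨c, hc, ψ, hψ, hψpos⟩ := exists_neg_weighted_eigenvector C w
    (fun u v => by
      simp only [hC, hK u v]
      by_cases huv : u = v
      · subst huv; ring
      · simp only [if_neg huv, if_neg (Ne.symm huv)]; ring) hw0
    (fun u hu v => by simp only [hC, hKw u hu v, hu]; simp) φ (by
      have : ∑ u, ∑ v, C u v * φ u * φ v = ∑ u, φ u * ∑ v, C u v * φ v := by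
        refine Finset.sum_congr rfl fun u _ => ?_
        rw [Finset.mul_sum]
        exact Finset.sum_congr rfl fun v _ => by ring
      rw [this]
      simp only [hCmul]
      push Not at hcon
      have e : ∑ u, φ u * (w u * φ u - ∑ v, K u v * φ v
          - lam * (w u * φ u - w u * (∑ v, w v * φ v) / M))
          = (∑ u, w u * φ u ^ 2 - ∑ u, ∑ v, K u v * φ u * φ v)
            - lam * (∑ u, w u * φ u ^ 2 - (∑ u, w u * φ u) ^ 2 / M) := by
        have e1 : ∀ u, φ u * (w u * φ u - ∑ v, K u v * φ v
          - lam * (w u * φ u - w u * (∑ v, w v * φ v) / M))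
          = w u * φ u ^ 2 - (∑ v, K u v * φ u * φ v) - lam * (w u * φ u ^ 2
            - (w u * φ u) * ((∑ v, w v * φ v) / M)) := by
          intro u
          have : ∑ v, K u v * φ u * φ v = φ u * ∑ v, K u v * φ v := by
            rw [Finset.mul_sum]
            exact Finset.sum_congr rfl fun v _ => by ring
          rw [this]; ring
        simp only [e1, Finset.sum_sub_distrib, ← Finset.mul_sum, ← Finset.sum_mul]
        ring
      rw [e]
      linarith)
  simp only [hCmul] at hψ
  have hKsum : ∑ u, ∑ v, K u v * ψ v = ∑ u, w u * ψ u := by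
    rw [Finset.sum_comm]
    refine Finset.sum_congr rfl fun u _ => ?_
    rw [← Finset.sum_mul]
    congr 1
    exact Finset.sum_congr rfl fun v _ => hK v u
  have hMpos : 0 < M := by
    refine lt_of_le_of_ne (Finset.sum_nonneg fun u _ => hw0 u) fun h0 => ?_
    have := (Finset.sum_eq_zero_iff_of_nonneg fun u _ => hw0 u).1 h0.symm
    exact absurd hψpos (by
      rw [Finset.sum_eq_zero fun u hu => by rw [this u hu, zero_mul]]; exact lt_irrefl _)
  -- Both the Laplacian and the variance form annihilate constants. Summing the eigenvalue equation
  -- over `u` therefore leaves `0 = c * ∑ u, w u * ψ u`.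
  have hmean : ∑ u, w u * ψ u = 0 := by
    have hs := Finset.sum_congr (rfl : (Finset.univ : Finset V) = _) fun u _ => hψ u
    simp only [Finset.sum_sub_distrib, ← Finset.mul_sum, hKsum, ← Finset.sum_div,
      ← Finset.sum_mul] at hs
    rw [← hM, mul_comm M, mul_div_assoc, div_self hMpos.ne'] at hs
    have : c * ∑ u, w u * ψ u = 0 := by rw [← hs]; ring
    exact (mul_eq_zero.1 this).resolve_left hc.ne
  have heig : ∀ u, w u * ψ u - ∑ v, K u v * ψ v = (lam + c) * (w u * ψ u) := by
    intro u
    have := hψ u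
    rw [hmean] at this
    simp only [mul_zero, zero_div, sub_zero] at this
    linarith
  by_cases hμ : lam + c = 0
  -- Eigenvalue `0` is not covered by `h`. Here `ψ` has no Dirichlet energy, so connectedness makes
  -- it constant, and mean zero makes it vanish on the support of `w`.
  · have hzero : ∑ u, ∑ v, K u v * (ψ u - ψ v) ^ 2 = 0 := by
      rw [sum_mul_sq_sub_sq K hK]
      have : ∑ u, w u * ψ u ^ 2 - ∑ u, ∑ v, K u v * ψ u * ψ v
          = ∑ u, ψ u * (w u * ψ u - ∑ v, K u v * ψ v) := by
        rw [← Finset.sum_sub_distrib]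
        refine Finset.sum_congr rfl fun u _ => ?_
        rw [mul_sub, Finset.mul_sum]
        congr 1
        · ring
        · exact Finset.sum_congr rfl fun v _ => by ring
      rw [this]
      simp [heig, hμ]
    have hedge : ∀ u v, 0 < K u v → ψ u = ψ v := by
      intro u v huv
      have h1 := (Finset.sum_eq_zero_iff_of_nonneg fun u _ => Finset.sum_nonneg fun v _ =>
        mul_nonneg (hK0 u v) (sq_nonneg (ψ u - ψ v))).1 hzero u (Finset.mem_univ u)
      have h2 := (Finset.sum_eq_zero_iff_of_nonneg fun v _ =>
        mul_nonneg (hK0 u v) (sq_nonneg (ψ u - ψ v))).1 h1 v (Finset.mem_univ v)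
      rcases mul_eq_zero.1 h2 with h3 | h3
      · exact absurd h3 huv.ne'
      · exact sub_eq_zero.1 (pow_eq_zero_iff (two_ne_zero)|>.1 h3)
    have hconst := hconn ψ hedge
    obtain ⟨u₀, -, hu₀⟩ := Finset.exists_ne_zero_of_sum_ne_zero hMpos.ne'
    have hu₀' : 0 < w u₀ := lt_of_le_of_ne (hw0 u₀) (Ne.symm hu₀)
    have hval : ∀ u, w u * ψ u = w u * ψ u₀ := by
      intro u
      rcases (hw0 u).eq_or_lt with h0 | h0
      · rw [← h0]; ring
      · rw [hconst u u₀ h0 hu₀']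
    have hψ0 : ψ u₀ = 0 := by
      simp only [hval, ← Finset.sum_mul] at hmean
      exact (mul_eq_zero.1 hmean).resolve_left hMpos.ne'
    refine hψpos.ne' (Finset.sum_eq_zero fun u _ => ?_)
    rw [pow_two, ← mul_assoc, hval, hψ0]; ring
  · have := h (lam + c) ψ hμ heig hψpos
    linarith

/-- Trickling down: if the slices of a symmetric tensor have gap `lam`, then so does, with constant
`2 - 1 / lam`, its contraction, provided that this is connected. -/
theorem hasGap_trickle_down {V : Type*} [Fintype V] [DecidableEq V] (T : V → V → V → ℝ)
    (K : V → V → ℝ) (hT0 : ∀ a b c, 0 ≤ T a b c) (hT1 : ∀ a b c, T a b c = T b a c)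
    (hT2 : ∀ a b c, T a b c = T a c b) (hTK : ∀ a b, ∑ c, T a b c = K a b)
    (hconn : EdgeConnected K) (lam : ℝ) (hlam : 0 < lam) (hgap : ∀ a, HasGap (T a) lam) :
    HasGap K (2 - 1 / lam) := by
  have hK : ∀ u v, K u v = K v u := fun u v => by simp only [← hTK, hT1 u v]
  have hK0 : ∀ u v, 0 ≤ K u v := fun u v => by
    rw [← hTK]; exact Finset.sum_nonneg fun c _ => hT0 u v c
  refine hasGap_of_eigenvalues K hK hK0 hconn _ fun μ ψ hμ heig hpos => ?_
  set w : V → ℝ := fun u => ∑ v, K u v with hwdef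
  have hw0 : ∀ u, 0 ≤ w u := fun u => Finset.sum_nonneg fun v _ => hK0 u v
  have hKψ : ∀ u, ∑ v, K u v * ψ v = (1 - μ) * (w u * ψ u) := fun u => by linarith [heig u]
  set N := ∑ u, w u * ψ u ^ 2 with hN
  have hform : ∑ u, ∑ v, K u v * ψ u * ψ v = (1 - μ) * N := by
    rw [hN, Finset.mul_sum]
    refine Finset.sum_congr rfl fun u _ => ?_
    have : ∑ v, K u v * ψ u * ψ v = ψ u * ∑ v, K u v * ψ v := by
      rw [Finset.mul_sum]
      exact Finset.sum_congr rfl fun v _ => by ring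
    rw [this, hKψ]; ring
  have hμ0 : 0 < μ := by
    have h1 := sum_mul_sq_sub_sq K hK ψ
    have h2 : 0 ≤ ∑ u, ∑ v, K u v * (ψ u - ψ v) ^ 2 :=
      Finset.sum_nonneg fun u _ => Finset.sum_nonneg fun v _ => mul_nonneg (hK0 u v) (sq_nonneg _)
    have h3 : ∑ u, (∑ v, K u v) * ψ u ^ 2 = N := rfl
    rw [h1, h3, hform] at h2
    have : 0 ≤ μ * N := by linarith
    exact lt_of_le_of_ne (nonneg_of_mul_nonneg_left this hpos) (Ne.symm hμ)
  -- Garland's localization: the gap inequalities of all slices, tested on the same eigenfunction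
  -- `ψ` of `K`, are added up.
  have hsum := Finset.sum_le_sum fun a (_ : a ∈ Finset.univ) => hgap a ψ
  simp only [hTK, ← Finset.mul_sum, Finset.sum_sub_distrib, hKψ] at hsum
  have e1 : ∑ a, ∑ u, K a u * ψ u ^ 2 = N := by
    rw [Finset.sum_comm, hN]
    refine Finset.sum_congr rfl fun u _ => ?_
    rw [← Finset.sum_mul]
    congr 1
    exact Finset.sum_congr rfl fun v _ => hK v u
  -- In the slice of `a`, the mean of `ψ` is `(1 - μ) * ψ a` by the eigenvalue equation.
  have e2 : ∑ a, ((1 - μ) * (w a * ψ a)) ^ 2 / ∑ u, K a u = (1 - μ) ^ 2 * N := by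
    rw [hN, Finset.mul_sum]
    refine Finset.sum_congr rfl fun a _ => ?_
    change ((1 - μ) * (w a * ψ a)) ^ 2 / w a = _
    by_cases ha : w a = 0
    · rw [ha]; simp
    · field_simp
  have e3 : ∑ a, ∑ u, ∑ v, T a u v * ψ u * ψ v = (1 - μ) * N := by
    rw [← hform, Finset.sum_comm]
    refine Finset.sum_congr rfl fun u _ => ?_
    rw [Finset.sum_comm]
    refine Finset.sum_congr rfl fun v _ => ?_
    rw [← hTK u v, Finset.sum_mul, Finset.sum_mul]
    refine Finset.sum_congr rfl fun a _ => ?_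
    rw [hT1 a u v, hT2 u a v]
  rw [e1, e2, e3] at hsum
  -- The added inequality reads `lam * (1 - (1 - μ) ^ 2) * N ≤ μ * N`, and `1 - (1 - μ) ^ 2 = μ * (2
  -- - μ)`.
  have h4 : (lam * (2 - μ) - 1) * (μ * N) ≤ 0 := by linarith
  have h5 : lam * (2 - μ) - 1 ≤ 0 := by
    by_contra h
    push Not at h
    have := mul_pos h (mul_pos hμ0 hpos)
    linarith
  have h6 : 2 - μ ≤ 1 / lam := by
    rw [le_div_iff₀ hlam]; linarith
  linarith

/-! ### Partite weights and flag sums. -/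

/-- A weight `F` on all finite sets of vertices, extended by zero outside an `(n + 1)`-partite
complex with sides `S`. -/
structure IsPartiteWeight {V : Type*} [Fintype V] [DecidableEq V] (n : ℕ) (S : Fin (n + 1) → Finset V)
    (F : Finset V → ℝ) : Prop where
  nonneg : ∀ τ, 0 ≤ F τ
  insert_eq_zero : ∀ τ u, F τ = 0 → F (insert u τ) = 0
  sum_insert : ∀ τ, τ.card ≤ n → ∑ u, (if u ∈ τ then 0 else F (insert u τ)) = F τ
  eq_zero_of_side : ∀ τ i u v, u ∈ τ → v ∈ τ → u ≠ v → u ∈ S i → v ∈ S i → F τ = 0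
  exists_side : ∀ τ u, F τ ≠ 0 → u ∈ τ → ∃ i, u ∈ S i
  disjoint : ∀ i j, i ≠ j → Disjoint (S i) (S j)

/-- The weighted sum of `F (τ ∪ {u₁, …, u_r})` over the new vertices `u₁, …, u_r`, where `u_k` is
weighted by the `k`-th function of the list. -/
def flagSum {V : Type*} [Fintype V] [DecidableEq V] (F : Finset V → ℝ) :
    List (V → ℝ) → Finset V → ℝ
  | [], τ => F τ
  | g :: L, τ => ∑ u, if u ∈ τ then 0 else g u * flagSum F L (insert u τ)

/-- The indicator function of a finite set. -/
def ind {V : Type*} [DecidableEq V] (U : Finset V) (v : V) : ℝ := if v ∈ U then 1 else 0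

theorem ind_nonneg {V : Type*} [DecidableEq V] (U : Finset V) (v : V) : 0 ≤ ind U v := by
  unfold ind; split_ifs <;> norm_num

theorem ind_le_one {V : Type*} [DecidableEq V] (U : Finset V) (v : V) : ind U v ≤ 1 := by
  unfold ind; split_ifs <;> norm_num

theorem ind_of_notMem {V : Type*} [DecidableEq V] {U : Finset V} {v : V} (h : v ∉ U) :
    ind U v = 0 := if_neg h

section flagSum

variable {V : Type*} [Fintype V] [DecidableEq V] {n : ℕ} {S : Fin (n + 1) → Finset V}
  {F : Finset V → ℝ}

theorem flagSum_cons (g : V → ℝ) (L : List (V → ℝ)) (τ : Finset V) :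
    flagSum F (g :: L) τ = ∑ u, if u ∈ τ then 0 else g u * flagSum F L (insert u τ) := rfl

theorem flagSum_nil (τ : Finset V) : flagSum F [] τ = F τ := rfl

theorem flagSum_add_cons (a b : ℝ) (f g : V → ℝ) (L : List (V → ℝ)) (τ : Finset V) :
    flagSum F ((fun u => a * f u + b * g u) :: L) τ
      = a * flagSum F (f :: L) τ + b * flagSum F (g :: L) τ := by
  simp only [flagSum_cons, Finset.mul_sum, ← Finset.sum_add_distrib]
  refine Finset.sum_congr rfl fun u _ => ?_
  split_ifs <;> ring

theorem flagSum_smul_cons (a : ℝ) (f : V → ℝ) (L : List (V → ℝ)) (τ : Finset V) :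
    flagSum F ((fun u => a * f u) :: L) τ = a * flagSum F (f :: L) τ := by
  simpa using flagSum_add_cons (F := F) a 0 f 0 L τ

/-- Both orders give the same sum over ordered pairs of distinct vertices outside `τ`, because `F`
sees only the resulting set. -/
theorem flagSum_swap (f g : V → ℝ) (L : List (V → ℝ)) (τ : Finset V) :
    flagSum F (f :: g :: L) τ = flagSum F (g :: f :: L) τ := by
  have key : ∀ f g : V → ℝ, flagSum F (f :: g :: L) τ = ∑ u, ∑ v,
      if u ∈ τ ∨ v ∈ τ ∨ u = v then 0 else f u * g v * flagSum F L (insert v (insert u τ)) := by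
    intro f g
    rw [flagSum_cons]
    refine Finset.sum_congr rfl fun u _ => ?_
    by_cases hu : u ∈ τ
    · simp [hu]
    · rw [if_neg hu, flagSum_cons, Finset.mul_sum]
      refine Finset.sum_congr rfl fun v _ => ?_
      by_cases hv : v ∈ insert u τ
      · rw [if_pos hv, if_pos, mul_zero]
        rcases Finset.mem_insert.1 hv with h | h
        · exact Or.inr (Or.inr h.symm)
        · exact Or.inr (Or.inl h)
      · rw [if_neg hv, if_neg]
        · ring
        · rw [Finset.mem_insert] at hv
          push Not at hv ⊢
          exact ⟨hu, hv.2, fun h => hv.1 h.symm⟩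
  rw [key, key, Finset.sum_comm]
  refine Finset.sum_congr rfl fun u _ => Finset.sum_congr rfl fun v _ => ?_
  rw [Finset.insert_comm u v τ, mul_comm (f v)]
  refine if_congr ?_ rfl rfl
  tauto

theorem flagSum_congr_tail {L L' : List (V → ℝ)} (h : ∀ τ, flagSum F L τ = flagSum F L' τ)
    (g : V → ℝ) (τ : Finset V) : flagSum F (g :: L) τ = flagSum F (g :: L') τ := by
  simp only [flagSum_cons, h]

theorem flagSum_perm {L L' : List (V → ℝ)} (h : L.Perm L') (τ : Finset V) :
    flagSum F L τ = flagSum F L' τ := by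
  induction h generalizing τ with
  | nil => rfl
  | cons g _ ih => exact flagSum_congr_tail ih g τ
  | swap f g L => exact flagSum_swap g f L τ
  | trans _ _ ih1 ih2 => rw [ih1, ih2]

theorem flagSum_nonneg (hF : IsPartiteWeight n S F) (L : List (V → ℝ))
    (hL : ∀ g ∈ L, ∀ v, 0 ≤ g v) (τ : Finset V) : 0 ≤ flagSum F L τ := by
  induction L generalizing τ with
  | nil => exact hF.nonneg τ
  | cons g L ih =>
    refine Finset.sum_nonneg fun u _ => ?_
    split_ifs
    · exact le_rfl
    · exact mul_nonneg (hL g List.mem_cons_self u)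
        (ih (fun k hk => hL k (List.mem_cons_of_mem _ hk)) _)

theorem flagSum_eq_zero (hF : IsPartiteWeight n S F) (L : List (V → ℝ)) (τ : Finset V)
    (hτ : F τ = 0) : flagSum F L τ = 0 := by
  induction L generalizing τ with
  | nil => exact hτ
  | cons g L ih =>
    refine Finset.sum_eq_zero fun u _ => ?_
    rw [ih _ (hF.insert_eq_zero τ u hτ), mul_zero, ite_self]

/-- Summing `F` over one further vertex returns `F`, so a further factor at most `1` cannot increase
the sum. The factor is placed last because `sum_insert` applies directly there. -/
theorem flagSum_append_singleton_le (hF : IsPartiteWeight n S F) (L : List (V → ℝ))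
    (hL : ∀ g ∈ L, ∀ v, 0 ≤ g v) (g : V → ℝ) (hg : ∀ v, g v ≤ 1) (τ : Finset V)
    (hτ : τ.card + L.length ≤ n) : flagSum F (L ++ [g]) τ ≤ flagSum F L τ := by
  induction L generalizing τ with
  | nil =>
    rw [List.nil_append, flagSum_nil, ← hF.sum_insert τ hτ]
    refine Finset.sum_le_sum fun u _ => ?_
    split_ifs
    · exact le_rfl
    · exact mul_le_of_le_one_left (hF.nonneg _) (hg u)
  | cons k L ih =>
    rw [List.cons_append, flagSum_cons, flagSum_cons]
    refine Finset.sum_le_sum fun u _ => ?_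
    split_ifs with hu
    · exact le_rfl
    · refine mul_le_mul_of_nonneg_left (ih (fun k hk => hL k (List.mem_cons_of_mem _ hk)) _ ?_)
        (hL k List.mem_cons_self u)
      rw [Finset.card_insert_of_notMem hu]
      simp only [List.length_cons] at hτ
      omega

theorem flagSum_cons_le (hF : IsPartiteWeight n S F) (L : List (V → ℝ))
    (hL : ∀ g ∈ L, ∀ v, 0 ≤ g v) (g : V → ℝ) (hg : ∀ v, g v ≤ 1) (τ : Finset V)
    (hτ : τ.card + L.length ≤ n) : flagSum F (g :: L) τ ≤ flagSum F L τ := by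
  rw [← flagSum_perm (List.perm_append_singleton g L)]
  exact flagSum_append_singleton_le hF L hL g hg τ hτ

theorem flagSum_le (hF : IsPartiteWeight n S F) (L : List (V → ℝ))
    (hL : ∀ g ∈ L, ∀ v, 0 ≤ g v) (hL1 : ∀ g ∈ L, ∀ v, g v ≤ 1) (τ : Finset V)
    (hτ : τ.card + L.length ≤ n + 1) : flagSum F L τ ≤ F τ := by
  induction L with
  | nil => exact le_rfl
  | cons g L ih =>
    have h1 : τ.card + L.length ≤ n := by
      simp only [List.length_cons] at hτ; omega
    exact (flagSum_cons_le hF L (fun k hk => hL k (List.mem_cons_of_mem _ hk)) g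
      (hL1 g List.mem_cons_self) τ h1).trans
      (ih (fun k hk => hL k (List.mem_cons_of_mem _ hk))
        (fun k hk => hL1 k (List.mem_cons_of_mem _ hk)) (by omega))

theorem flagSum_cons_le_singleton (hF : IsPartiteWeight n S F) (L : List (V → ℝ))
    (hL : ∀ g ∈ L, ∀ v, 0 ≤ g v) (hL1 : ∀ g ∈ L, ∀ v, g v ≤ 1) (g : V → ℝ) (hg : ∀ v, 0 ≤ g v)
    (τ : Finset V) (hτ : τ.card + L.length ≤ n) : flagSum F (g :: L) τ ≤ flagSum F [g] τ := by
  rw [flagSum_cons, flagSum_cons]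
  refine Finset.sum_le_sum fun u _ => ?_
  split_ifs with hu
  · exact le_rfl
  · refine mul_le_mul_of_nonneg_left (flagSum_le hF L hL hL1 _ ?_) (hg u)
    rw [Finset.card_insert_of_notMem hu]
    omega

/-- The side `S j` carries an equal share of the weight of a face that does not meet it. -/
theorem side_weight_eq (hF : IsPartiteWeight n S F) (j : Fin (n + 1)) (τ : Finset V)
    (hτ : τ.card ≤ n + 1) (hj : ∀ u ∈ τ, u ∉ S j) :
    ((n : ℝ) + 1 - τ.card) * flagSum F [ind (S j)] τ = F τ := by
  -- Descending induction on the size of the face, starting from `n + 1` vertices.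
  obtain ⟨k, hk⟩ : ∃ k, τ.card + k = n + 1 := ⟨n + 1 - τ.card, by omega⟩
  induction k generalizing τ with
  | zero =>
    -- Pigeonhole: `n + 1` vertices in the `n` sides other than `S j` put two vertices into one
    -- side.
    have h0 : F τ = 0 := by
      by_contra hne
      choose! c hc using fun u (hu : u ∈ τ) => hF.exists_side τ u hne hu
      have hmaps : ∀ u ∈ τ, c u ∈ (Finset.univ.erase j : Finset (Fin (n + 1))) := by
        intro u hu
        refine Finset.mem_erase.2 ⟨?_, Finset.mem_univ _⟩
        rintro rfl
        exact hj u hu (hc u hu)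
      obtain ⟨u, hu, v, hv, huv, hcuv⟩ := Finset.exists_ne_map_eq_of_card_lt_of_maps_to
        (by rw [Finset.card_erase_of_mem (Finset.mem_univ _), Finset.card_univ, Fintype.card_fin]
            omega) hmaps
      exact hne (hF.eq_zero_of_side τ (c u) u v hu hv huv (hc u hu) (hcuv ▸ hc v hv))
    rw [h0, flagSum_eq_zero hF _ _ h0, mul_zero]
  | succ k ih =>
    have hk1 : τ.card ≤ n := by omega
    have hins : ∀ v, v ∉ τ → v ∉ S j → F (insert v τ)
        = ((n : ℝ) - τ.card) * flagSum F [ind (S j)] (insert v τ) := by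
      intro v hv hvS
      have hc := Finset.card_insert_of_notMem hv
      rw [← ih (insert v τ) (by omega) (fun u hu => by
        rcases Finset.mem_insert.1 hu with rfl | h
        · exact hvS
        · exact hj u h) (by omega), hc]
      push_cast
      ring
    have hside : ∀ v, v ∈ S j → flagSum F [ind (S j)] (insert v τ) = 0 := by
      intro v hv
      refine Finset.sum_eq_zero fun u _ => ?_
      split_ifs with hu
      · rfl
      · by_cases huS : u ∈ S j
        · rw [flagSum_nil, hF.eq_zero_of_side _ j u v (Finset.mem_insert_self _ _)
            (Finset.mem_insert_of_mem (Finset.mem_insert_self _ _))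
            (fun h => hu (h ▸ Finset.mem_insert_self _ _)) huS hv, mul_zero]
        · rw [ind_of_notMem huS, zero_mul]
    -- The next vertex `v` lies in `S j` or not. In the second case the induction hypothesis
    -- expresses the weight through a further vertex in `S j`; in the first case no further vertex
    -- of `S j` fits.
    have hsplit : F τ = flagSum F [ind (S j)] τ
        + ((n : ℝ) - τ.card) * flagSum F [fun _ => 1, ind (S j)] τ := by
      conv_lhs => rw [← hF.sum_insert τ hk1]
      rw [flagSum_cons, flagSum_cons, Finset.mul_sum, ← Finset.sum_add_distrib]
      refine Finset.sum_congr rfl fun v _ => ?_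
      by_cases hv : v ∈ τ
      · simp [hv]
      · rw [if_neg hv, if_neg hv, if_neg hv, flagSum_nil]
        by_cases hvS : v ∈ S j
        · rw [hside v hvS, ind, if_pos hvS]; ring
        · rw [ind_of_notMem hvS, hins v hv hvS]; ring
    have hone : ((n : ℝ) - τ.card) * flagSum F [fun _ => 1, ind (S j)] τ
        = ((n : ℝ) - τ.card) * flagSum F [ind (S j)] τ := by
      -- For `τ.card = n` there is no room for two more vertices, but the factor vanishes. Otherwise
      -- the unrestricted vertex is summed last and disappears.
      rcases hk1.eq_or_lt with h | h
      · rw [h]; ring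
      · congr 1
        rw [flagSum_swap, flagSum_cons, flagSum_cons]
        refine Finset.sum_congr rfl fun v _ => ?_
        split_ifs with hv
        · rfl
        · rw [flagSum_nil, ← hF.sum_insert (insert v τ)
            (by rw [Finset.card_insert_of_notMem hv]; omega), flagSum_cons]
          simp only [one_mul, flagSum_nil]
    rw [hone] at hsplit
    linarith

/-- The vertices chosen by `L` avoid `S j` or contribute zero, so `side_weight_eq` applies to the
completed face, which has `τ.card + L.length` vertices. -/
theorem flagSum_append_side (hF : IsPartiteWeight n S F) (j : Fin (n + 1)) (L : List (V → ℝ))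
    (hL : ∀ g ∈ L, ∀ v ∈ S j, g v = 0) (τ : Finset V) (hτ : τ.card + L.length ≤ n + 1)
    (hj : ∀ u ∈ τ, u ∉ S j) :
    ((n : ℝ) + 1 - τ.card - L.length) * flagSum F (L ++ [ind (S j)]) τ = flagSum F L τ := by
  induction L generalizing τ with
  | nil => simpa [flagSum_nil] using side_weight_eq hF j τ hτ hj
  | cons g L ih =>
    rw [List.cons_append, flagSum_cons, flagSum_cons, Finset.mul_sum]
    refine Finset.sum_congr rfl fun u _ => ?_
    split_ifs with hu
    · rw [mul_zero]
    · by_cases huS : u ∈ S j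
      · rw [hL g List.mem_cons_self u huS]; ring
      · have hc := Finset.card_insert_of_notMem hu
        simp only [List.length_cons] at hτ
        rw [← ih (fun k hk => hL k (List.mem_cons_of_mem _ hk)) (insert u τ) (by omega)
          (fun v hv => by
            rcases Finset.mem_insert.1 hv with rfl | h
            · exact huS
            · exact hj v h), hc]
        simp only [List.length_cons]
        push_cast
        ring

theorem flagSum_cons_side (hF : IsPartiteWeight n S F) (j : Fin (n + 1)) (L : List (V → ℝ))
    (hL : ∀ g ∈ L, ∀ v ∈ S j, g v = 0) (τ : Finset V) (hτ : τ.card + L.length ≤ n + 1)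
    (hj : ∀ u ∈ τ, u ∉ S j) :
    ((n : ℝ) + 1 - τ.card - L.length) * flagSum F (ind (S j) :: L) τ = flagSum F L τ := by
  rw [← flagSum_append_side hF j L hL τ hτ hj,
    flagSum_perm (List.perm_append_singleton (ind (S j)) L)]

/-! ### Spectral gaps of the links and correlation of two sides. -/

/-- The edge weights of the link of `τ`. -/
def linkEdge (F : Finset V → ℝ) (τ : Finset V) (u v : V) : ℝ :=
  if u ∈ τ ∨ v ∈ τ ∨ u = v then 0 else F (insert u (insert v τ))

theorem linkEdge_comm {V : Type*} [DecidableEq V] (F : Finset V → ℝ) (τ : Finset V) (u v : V) :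
    linkEdge F τ u v = linkEdge F τ v u := by
  unfold linkEdge
  rw [Finset.insert_comm]
  exact if_congr (by tauto) rfl rfl

theorem linkEdge_nonneg (hF : IsPartiteWeight n S F) (τ : Finset V) (u v : V) :
    0 ≤ linkEdge F τ u v := by
  unfold linkEdge
  split_ifs
  · exact le_rfl
  · exact hF.nonneg _

theorem sum_linkEdge (hF : IsPartiteWeight n S F) (τ : Finset V) (hτ : τ.card + 1 ≤ n) (u : V) :
    ∑ v, linkEdge F τ u v = if u ∈ τ then 0 else F (insert u τ) := by
  split_ifs with hu
  · exact Finset.sum_eq_zero fun v _ => if_pos (Or.inl hu)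
  · rw [← hF.sum_insert (insert u τ) (by rw [Finset.card_insert_of_notMem hu]; exact hτ)]
    refine Finset.sum_congr rfl fun v _ => ?_
    rw [linkEdge, Finset.insert_comm u v]
    refine if_congr ?_ rfl rfl
    rw [Finset.mem_insert, eq_comm (a := v)]
    tauto

theorem sum_linkEdge_mul (τ : Finset V) (f g : V → ℝ) :
    ∑ u, ∑ v, linkEdge F τ u v * f u * g v = flagSum F [f, g] τ := by
  rw [flagSum_cons]
  refine Finset.sum_congr rfl fun u _ => ?_
  split_ifs with hu
  · refine Finset.sum_eq_zero fun v _ => ?_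
    rw [linkEdge, if_pos (Or.inl hu)]; ring
  · rw [flagSum_cons, Finset.mul_sum]
    refine Finset.sum_congr rfl fun v _ => ?_
    rw [linkEdge, flagSum_nil, Finset.insert_comm u v]
    by_cases hv : v ∈ insert u τ
    · rw [if_pos hv, if_pos]
      · ring
      · rw [Finset.mem_insert, eq_comm] at hv; tauto
    · rw [if_neg hv, if_neg]
      · ring
      · rw [Finset.mem_insert, eq_comm] at hv; tauto

theorem sum_sum_linkEdge_mul (hF : IsPartiteWeight n S F) (τ : Finset V) (hτ : τ.card + 1 ≤ n)
    (f : V → ℝ) : ∑ u, (∑ v, linkEdge F τ u v) * f u = flagSum F [f] τ := by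
  rw [flagSum_cons]
  refine Finset.sum_congr rfl fun u _ => ?_
  rw [sum_linkEdge hF τ hτ]
  split_ifs
  · ring
  · rw [flagSum_nil]; ring

/-- The spectral gap of the one-dimensional links passes to all links. -/
theorem hasGap_linkEdge (hF : IsPartiteWeight n S F)
    (hconn : ∀ τ : Finset V, τ.card + 1 ≤ n → EdgeConnected (linkEdge F τ)) (ε : ℝ)
    (hε : n * ε < 1) (hbase : ∀ τ : Finset V, τ.card + 1 = n → HasGap (linkEdge F τ) (1 - ε))
    (t : ℕ) (τ : Finset V) (hτ : τ.card + (t + 1) = n) :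
    HasGap (linkEdge F τ) (1 - ε / (1 - t * ε)) := by
  induction t generalizing τ with
  | zero => simpa using hbase τ (by omega)
  | succ t ih =>
    -- Here `ε` may be negative, namely when the gap exceeds `1`.
    have hpos : ∀ k : ℕ, k ≤ n → 0 < 1 - k * ε := by
      intro k hk
      have hkn : (k : ℝ) ≤ n := by exact_mod_cast hk
      rcases le_total ε 0 with h | h
      · nlinarith [Nat.cast_nonneg (α := ℝ) k]
      · nlinarith
    have h1 := hpos t (by omega)
    have h2 := hpos (t + 1) (by omega)
    push_cast at h2 ⊢
    rw [show 1 - ((t : ℝ) + 1) * ε = 1 - t * ε - ε by ring] at h2 ⊢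
    set p : ℝ := 1 - t * ε
    have hlam : 1 - ε / p = (p - ε) / p := by
      rw [sub_div, div_self h1.ne']
    have hlampos : 0 < 1 - ε / p := by rw [hlam]; positivity
    -- The closed form follows the recursion `x ↦ 2 - 1 / x`, which lowers the denominator `p` by
    -- `ε`.
    have hnext : 1 - ε / (p - ε) = 2 - 1 / (1 - ε / p) := by
      rw [hlam, one_div_div, eq_sub_iff_add_eq, sub_add, ← sub_div,
        show ε - p = -(p - ε) by ring, neg_div, div_self h2.ne']
      norm_num
    rw [hnext]
    -- This form shows that the tensor is symmetric: it is the weight of `τ ∪ {a, b, c}` on triples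
    -- of distinct vertices outside `τ`.
    have hT : ∀ a b c, (if a ∈ τ then 0 else linkEdge F (insert a τ) b c)
        = if a ∈ τ ∨ b ∈ τ ∨ c ∈ τ ∨ a = b ∨ a = c ∨ b = c then 0
          else F (insert a (insert b (insert c τ))) := by
      intro a b c
      rw [linkEdge, Finset.insert_comm c a τ, Finset.insert_comm b a]
      simp only [Finset.mem_insert, ← ite_or]
      refine if_congr ?_ rfl rfl
      rw [eq_comm (a := b) (b := a), eq_comm (a := c) (b := a)]
      tauto
    refine hasGap_trickle_down (fun a b c => if a ∈ τ then 0 else linkEdge F (insert a τ) b c)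
      (linkEdge F τ) ?_ ?_ ?_ ?_ (hconn τ (by omega)) _ hlampos ?_
    · intro a b c
      split_ifs
      · exact le_rfl
      · exact linkEdge_nonneg hF _ _ _
    · intro a b c
      rw [hT, hT, Finset.insert_comm a b]
      refine if_congr ?_ rfl rfl
      rw [eq_comm (a := b) (b := a)]
      tauto
    · intro a b c
      rw [hT, hT, Finset.insert_comm b c]
      refine if_congr ?_ rfl rfl
      rw [eq_comm (a := c) (b := b)]
      tauto
    · intro a b
      by_cases ha : a ∈ τ
      · simp [ha, linkEdge]
      · simp only [if_neg ha]
        rw [sum_linkEdge hF (insert a τ) (by rw [Finset.card_insert_of_notMem ha]; omega), linkEdge,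
          Finset.insert_comm a b]
        refine if_congr ?_ rfl rfl
        rw [Finset.mem_insert, eq_comm (a := b) (b := a)]
        tauto
    · intro a
      by_cases ha : a ∈ τ
      -- The slice is zero, and the zero graph satisfies every Poincaré inequality.
      · intro φ; simp [ha]
      · simp only [if_neg ha]
        exact ih (insert a τ) (by rw [Finset.card_insert_of_notMem ha]; omega)

/-- The correlation bound for functions on two different sides of the link of `τ`. -/
theorem two_mul_flagSum_pair_le (hF : IsPartiteWeight n S F) (τ : Finset V) (hτ : τ.card + 1 ≤ n)
    (lam e : ℝ) (hgap : HasGap (linkEdge F τ) lam) (he : 0 ≤ e) (hlam : 1 - lam ≤ e)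
    (i j : Fin (n + 1)) (hij : i ≠ j) (hj : ∀ u ∈ τ, u ∉ S j)
    (f h : V → ℝ) (hf : ∀ v, v ∉ S i → f v = 0) (hh : ∀ v, v ∉ S j → h v = 0)
    (hf0 : flagSum F [f] τ = 0) :
    2 * flagSum F [h, f] τ
      ≤ e * (flagSum F [fun v => f v ^ 2] τ + flagSum F [fun v => h v ^ 2] τ) := by
  have hfj : ∀ v ∈ S j, f v = 0 := fun v hv =>
    hf v fun hvi => Finset.disjoint_left.1 (hF.disjoint i j hij) hvi hv
  set D := flagSum F [ind (S j)] τ with hD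
  set c := flagSum F [h] τ / D with hc
  have hcD : c * D = flagSum F [h] τ := by
    -- If the side has no weight in the link, then `F τ = 0` and both sides vanish.
    by_cases hD0 : D = 0
    · have := side_weight_eq hF j τ (by omega) hj
      rw [← hD, hD0, mul_zero] at this
      rw [hD0, mul_zero, flagSum_eq_zero hF _ _ this.symm]
    · rw [hc]; field_simp
  -- The function `h` is centred on its own side. By the equal share of `S j`, the subtracted
  -- constant pairs with `f` to a multiple of the mean of `f`, which is zero.
  set k : V → ℝ := fun v => 1 * h v + (-c) * ind (S j) v with hk
  have hk0 : ∀ v, v ∉ S j → k v = 0 := fun v hv => by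
    simp only [hk, hh v hv, ind_of_notMem hv]; ring
  have hkmean : flagSum F [k] τ = 0 := by
    rw [hk, flagSum_add_cons, ← hD]; linarith
  have hside : flagSum F [ind (S j), f] τ = 0 := by
    have := flagSum_cons_side hF j [f] (by simpa using hfj) τ (by simpa using by omega) hj
    rw [hf0] at this
    refine (mul_eq_zero.1 this).resolve_left ?_
    have : (τ.card : ℝ) + 1 ≤ n := by exact_mod_cast hτ
    simp only [List.length_singleton, Nat.cast_one]
    linarith
  have hkf : flagSum F [k, f] τ = flagSum F [h, f] τ := by
    rw [hk, flagSum_add_cons, hside]; ring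
  have hsame : ∀ (i : Fin (n + 1)) (f : V → ℝ), (∀ v, v ∉ S i → f v = 0) →
      flagSum F [f, f] τ = 0 := by
    intro i f hf
    rw [← sum_linkEdge_mul]
    refine Finset.sum_eq_zero fun u _ => Finset.sum_eq_zero fun v _ => ?_
    by_cases hu : u ∈ S i
    · by_cases hv : v ∈ S i
      · rw [linkEdge]
        split_ifs with h
        · ring
        · rw [hF.eq_zero_of_side _ i u v (by simp) (by simp) (by tauto) hu hv]; ring
      · rw [hf v hv]; ring
    · rw [hf u hu]; ring
  have hsq : flagSum F [fun v => (1 * f v + 1 * k v) ^ 2] τ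
      = flagSum F [fun v => f v ^ 2] τ + flagSum F [fun v => k v ^ 2] τ := by
    rw [← one_mul (flagSum F [fun v => f v ^ 2] τ), ← one_mul (flagSum F [fun v => k v ^ 2] τ),
      ← flagSum_add_cons]
    congr 2
    funext v
    by_cases hv : v ∈ S j
    · rw [hfj v hv]; ring
    · rw [hk0 v hv]; ring
  have hksq : flagSum F [fun v => k v ^ 2] τ ≤ flagSum F [fun v => h v ^ 2] τ := by
    have h1 : (fun v => k v ^ 2)
        = fun v => 1 * h v ^ 2 + 1 * ((-2 * c) * h v + c ^ 2 * ind (S j) v) := by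
      funext v
      by_cases hv : v ∈ S j
      · simp only [hk, ind, if_pos hv]; ring
      · rw [hk0 v hv, hh v hv, ind_of_notMem hv]; ring
    rw [h1, flagSum_add_cons, flagSum_add_cons, ← hD, ← hcD]
    have : 0 ≤ D := flagSum_nonneg hF _ (by simpa using ind_nonneg _) _
    nlinarith [mul_nonneg (sq_nonneg c) this]
  clear_value k
  -- No edge lies inside a side, so only the cross terms of `f + k` survive.
  have hff : flagSum F [fun v => 1 * f v + 1 * k v, fun v => 1 * f v + 1 * k v] τ
      = 2 * flagSum F [h, f] τ := by
    rw [flagSum_add_cons, flagSum_swap f, flagSum_add_cons,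
      flagSum_swap k (fun v => 1 * f v + 1 * k v), flagSum_add_cons, flagSum_swap f k, hsame i f hf, hsame j k hk0, hkf]
    ring
  have hmean : flagSum F [fun v => 1 * f v + 1 * k v] τ = 0 := by
    rw [flagSum_add_cons, hf0, hkmean]; ring
  have hφ := hgap fun v => 1 * f v + 1 * k v
  rw [sum_linkEdge_mul, sum_sum_linkEdge_mul hF τ hτ, sum_sum_linkEdge_mul hF τ hτ, hff, hmean,
    hsq] at hφ
  have hA : 0 ≤ flagSum F [fun v => f v ^ 2] τ :=
    flagSum_nonneg hF _ (by simpa using fun v => sq_nonneg _) _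
  have hB : 0 ≤ flagSum F [fun v => k v ^ 2] τ :=
    flagSum_nonneg hF _ (by simpa using fun v => sq_nonneg _) _
  rw [zero_pow two_ne_zero, zero_div, sub_zero] at hφ
  linarith [mul_le_mul_of_nonneg_right hlam (add_nonneg hA hB), mul_le_mul_of_nonneg_left hksq he]

end flagSum

/-! ### Correlation of one side with a product over several sides. -/

section flagSum

variable {V : Type*} [Fintype V] [DecidableEq V] {n : ℕ} {S : Fin (n + 1) → Finset V}
  {F : Finset V → ℝ}

/-- The correlation bound with constant `e` for all pairs of sides in all links. -/
def PairBound (S : Fin (n + 1) → Finset V) (F : Finset V → ℝ) (e : ℝ) : Prop :=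
  ∀ (τ : Finset V) (i j : Fin (n + 1)) (f h : V → ℝ), τ.card + 1 ≤ n → i ≠ j →
    (∀ u ∈ τ, u ∉ S j) → (∀ v, v ∉ S i → f v = 0) → (∀ v, v ∉ S j → h v = 0) →
    flagSum F [f] τ = 0 → 2 * flagSum F [h, f] τ
      ≤ e * (flagSum F [fun v => f v ^ 2] τ + flagSum F [fun v => h v ^ 2] τ)

/-- Weights between `0` and `1` on the vertices of each side. -/
structure IsSideWeight (S : Fin (n + 1) → Finset V) (g : Fin (n + 1) → V → ℝ) : Prop where
  nonneg : ∀ i v, 0 ≤ g i v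
  le_one : ∀ i v, g i v ≤ 1
  eq_zero : ∀ i v, v ∉ S i → g i v = 0

theorem IsSideWeight.map_nonneg {V : Type*} {n : ℕ} {S : Fin (n + 1) → Finset V}
    {g : Fin (n + 1) → V → ℝ} (hg : IsSideWeight S g)
    (J : List (Fin (n + 1))) : ∀ k ∈ J.map g, ∀ v, 0 ≤ k v := by
  intro k hk
  obtain ⟨i, -, rfl⟩ := List.mem_map.1 hk
  exact hg.nonneg i

theorem IsSideWeight.map_le_one {V : Type*} {n : ℕ} {S : Fin (n + 1) → Finset V}
    {g : Fin (n + 1) → V → ℝ} (hg : IsSideWeight S g)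
    (J : List (Fin (n + 1))) : ∀ k ∈ J.map g, ∀ v, k v ≤ 1 := by
  intro k hk
  obtain ⟨i, -, rfl⟩ := List.mem_map.1 hk
  exact hg.le_one i

/-- A mean-zero function on the side `S i` is almost uncorrelated with a product of functions on
other sides. -/
theorem two_mul_flagSum_cons_le (hF : IsPartiteWeight n S F) {e : ℝ} (he : 0 ≤ e)
    (hpair : PairBound S F e) {g : Fin (n + 1) → V → ℝ} (hg : IsSideWeight S g)
    (J : List (Fin (n + 1))) (i : Fin (n + 1)) (f : V → ℝ) (τ : Finset V) (hJ : (i :: J).Nodup)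
    (hτ : τ.card + J.length ≤ n) (hdisj : ∀ k ∈ i :: J, ∀ u ∈ τ, u ∉ S k)
    (hf : ∀ v, v ∉ S i → f v = 0) (hf0 : flagSum F [f] τ = 0) :
    2 * flagSum F (f :: J.map g) τ ≤ J.length * ((n + 1) * e) *
      (flagSum F [fun v => f v ^ 2] τ + flagSum F (J.map g) τ) := by
  induction J generalizing f τ with
  | nil => simp [hf0]
  | cons j J ih =>
    set L := J.map g with hL
    have hL0 := hg.map_nonneg J
    have hL1 := hg.map_le_one J
    have hij : i ≠ j := fun h => (List.nodup_cons.1 hJ).1 (h ▸ List.mem_cons_self)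
    have hjJ : j ∉ J := (List.nodup_cons.1 (List.nodup_cons.1 hJ).2).1
    have hJ' : (i :: J).Nodup := List.nodup_cons.2
      ⟨fun h => (List.nodup_cons.1 hJ).1 (List.mem_cons_of_mem _ h),
        (List.nodup_cons.1 (List.nodup_cons.1 hJ).2).2⟩
    simp only [List.length_cons] at hτ
    -- In the link of `a`, `D a` is the weight of `S i`, and `Y a` is the flag sum with `f` replaced
    -- by `1` on `S i`. Replacing `f` by its conditional mean there contributes `g j a * (Y a / D a)
    -- * flagSum F [f] (insert a τ)`, so `h` collects the weights of a correlation between `S j` and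
    -- `S i`.
    set D : V → ℝ := fun a => flagSum F [ind (S i)] (insert a τ) with hD
    set Y : V → ℝ := fun a => flagSum F (ind (S i) :: L) (insert a τ) with hY
    set h : V → ℝ := fun a => if a ∈ τ then 0 else g j a * (Y a / D a) with hh
    set C : ℝ := J.length * ((n + 1) * e) with hC
    have hC0 : 0 ≤ C := by positivity
    have hD0 : ∀ a, 0 ≤ D a := fun a => flagSum_nonneg hF _ (by simpa using ind_nonneg _) _
    have hY0 : ∀ a, 0 ≤ Y a := fun a => flagSum_nonneg hF _ (fun k hk => by
      rcases List.mem_cons.1 hk with rfl | hk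
      · exact ind_nonneg _
      · exact hL0 k hk) _
    have hcard : ∀ a, a ∉ τ → (insert a τ).card = τ.card + 1 :=
      fun a ha => Finset.card_insert_of_notMem ha
    have hYD : ∀ a, a ∉ τ → Y a ≤ D a := fun a ha =>
      flagSum_cons_le_singleton hF L hL0 hL1 _ (ind_nonneg _) _ (by
        rw [hcard a ha, hL, List.length_map]; omega)
    have hYL : ∀ a, a ∉ τ → Y a ≤ flagSum F L (insert a τ) := fun a ha =>
      flagSum_cons_le hF L hL0 _ (ind_le_one _) _ (by
        rw [hcard a ha, hL, List.length_map]; omega)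
    have hdisj' : ∀ a ∈ S j, ∀ k ∈ i :: J, ∀ u ∈ insert a τ, u ∉ S k := by
      intro a ha k hk u hu
      have hkj : k ≠ j := by
        rintro rfl
        rcases List.mem_cons.1 hk with h | h
        · exact hij h.symm
        · exact hjJ h
      rcases Finset.mem_insert.1 hu with rfl | hu
      · exact fun huk => Finset.disjoint_left.1 (hF.disjoint k j hkj) huk ha
      · refine hdisj k ?_ u hu
        rcases List.mem_cons.1 hk with h | h
        · exact h ▸ List.mem_cons_self
        · exact List.mem_cons_of_mem _ (List.mem_cons_of_mem _ h)
    have hFD : ∀ a, a ∉ τ → a ∈ S j → F (insert a τ) = ((n : ℝ) - τ.card) * D a := by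
      intro a ha haj
      rw [← side_weight_eq hF i (insert a τ) (by rw [hcard a ha]; omega)
        (hdisj' a haj i List.mem_cons_self), hcard a ha]
      push_cast
      ring
    have hstep : ∀ a, a ∉ τ → 2 * (g j a * flagSum F (f :: L) (insert a τ))
        ≤ C * (g j a * flagSum F [fun v => f v ^ 2] (insert a τ)
          + g j a * flagSum F L (insert a τ)) + 2 * (h a * flagSum F [f] (insert a τ)) := by
      intro a ha
      by_cases haj : a ∈ S j
      · set c := flagSum F [f] (insert a τ) / D a with hc
        have hcD : c * D a = flagSum F [f] (insert a τ) := by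
          by_cases h0 : D a = 0
          · rw [h0, mul_zero, flagSum_eq_zero hF]
            rw [hFD a ha haj, h0, mul_zero]
          · rw [hc, div_mul_cancel₀ _ h0]
        have hcY : c * Y a = Y a / D a * flagSum F [f] (insert a τ) := by rw [hc]; ring
        -- The part of `f` with mean zero in the link of `a`. Centring does not increase the square
        -- norm, so the induction hypothesis costs no more than for `f`.
        set k : V → ℝ := fun v => 1 * f v + (-c) * ind (S i) v with hk
        have hk0 : ∀ v, v ∉ S i → k v = 0 := fun v hv => by
          simp only [hk, hf v hv, ind_of_notMem hv]; ring
        have hkmean : flagSum F [k] (insert a τ) = 0 := by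
          rw [hk, flagSum_add_cons, ← hcD]; ring
        have hkL : flagSum F (k :: L) (insert a τ)
            = flagSum F (f :: L) (insert a τ) - c * Y a := by
          rw [hk, flagSum_add_cons]; ring
        have hksq : flagSum F [fun v => k v ^ 2] (insert a τ)
            ≤ flagSum F [fun v => f v ^ 2] (insert a τ) := by
          have h1 : (fun v => k v ^ 2)
              = fun v => 1 * f v ^ 2 + 1 * ((-2 * c) * f v + c ^ 2 * ind (S i) v) := by
            funext v
            by_cases hv : v ∈ S i
            · simp only [hk, ind, if_pos hv]; ring
            · rw [hk0 v hv, hf v hv, ind_of_notMem hv]; ring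
          rw [h1, flagSum_add_cons, flagSum_add_cons, ← hcD]
          linarith [mul_nonneg (sq_nonneg c) (hD0 a),
            show c ^ 2 * D a = c * (c * D a) by ring,
            show c ^ 2 * flagSum F [ind (S i)] (insert a τ) = c ^ 2 * D a from rfl]
        have hIH := ih k (insert a τ) hJ' (by rw [hcard a ha]; omega) (hdisj' a haj) hk0 hkmean
        rw [hkL] at hIH
        have h2 : 2 * (flagSum F (f :: L) (insert a τ) - c * Y a)
            ≤ C * (flagSum F [fun v => f v ^ 2] (insert a τ) + flagSum F L (insert a τ)) :=
          hIH.trans (mul_le_mul_of_nonneg_left (add_le_add hksq le_rfl) hC0)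
        have h3 := mul_le_mul_of_nonneg_left h2 (hg.nonneg j a)
        have h4 : h a * flagSum F [f] (insert a τ) = g j a * (c * Y a) := by
          rw [hcY]; simp only [hh, if_neg ha]; ring
        rw [h4]
        linarith
      · simp [hh, hg.eq_zero j a haj]
    have hsum : 2 * flagSum F (f :: g j :: L) τ ≤ C * (flagSum F [g j, fun v => f v ^ 2] τ
        + flagSum F (g j :: L) τ) + 2 * flagSum F [h, f] τ := by
      rw [flagSum_swap]
      simp only [flagSum_cons _ _ τ, Finset.mul_sum, ← Finset.sum_add_distrib]
      refine Finset.sum_le_sum fun a _ => ?_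
      by_cases ha : a ∈ τ
      · simp [ha]
      · simp only [if_neg ha]
        exact hstep a ha
    have hsq : flagSum F [g j, fun v => f v ^ 2] τ ≤ flagSum F [fun v => f v ^ 2] τ :=
      flagSum_cons_le hF _ (by simpa using fun v => sq_nonneg _) _ (hg.le_one j) _
        (by simp only [List.length_singleton]; omega)
    have hpr := hpair τ i j f h (by omega) hij
      (hdisj j (List.mem_cons_of_mem _ List.mem_cons_self)) hf
      (fun v hv => by simp only [hh, hg.eq_zero j v hv, zero_mul, ite_self]) hf0
    -- Since `0 ≤ h ≤ 1`, one power of `h` can be dropped; the factor `n - τ.card ≤ n` is the ratio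
    -- of `F (insert a τ)` to `D a`. The pair bound then costs `e * (A + n * B)`, whence `(n + 1) *
    -- e` per additional side.
    have hhsq : flagSum F [fun v => h v ^ 2] τ ≤ n * flagSum F (g j :: L) τ := by
      rw [flagSum_cons, flagSum_cons, Finset.mul_sum]
      refine Finset.sum_le_sum fun a _ => ?_
      by_cases ha : a ∈ τ
      · simp [ha]
      · simp only [if_neg ha, flagSum_nil, hh]
        by_cases haj : a ∈ S j
        · have hq0 : 0 ≤ Y a / D a := div_nonneg (hY0 a) (hD0 a)
          have hq1 : Y a / D a ≤ 1 := div_le_one_of_le₀ (hYD a ha) (hD0 a)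
          have hqD : Y a / D a * D a ≤ Y a := by
            by_cases h0 : D a = 0
            · rw [h0, mul_zero]; exact hY0 a
            · rw [div_mul_cancel₀ _ h0]
          have hgq : (g j a * (Y a / D a)) ^ 2 ≤ g j a * (Y a / D a) := by
            rw [pow_two]
            exact mul_le_of_le_one_left (mul_nonneg (hg.nonneg j a) hq0)
              (mul_le_one₀ (hg.le_one j a) hq0 hq1)
          calc (g j a * (Y a / D a)) ^ 2 * F (insert a τ)
              ≤ g j a * (Y a / D a) * F (insert a τ) :=
                mul_le_mul_of_nonneg_right hgq (hF.nonneg _)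
            _ = ((n : ℝ) - τ.card) * (g j a * (Y a / D a * D a)) := by rw [hFD a ha haj]; ring
            _ ≤ n * (g j a * flagSum F L (insert a τ)) := by
                refine mul_le_mul ?_ ?_ ?_ (Nat.cast_nonneg _)
                · linarith [Nat.cast_nonneg (α := ℝ) τ.card]
                · exact mul_le_mul_of_nonneg_left (hqD.trans (hYL a ha)) (hg.nonneg j a)
                · exact mul_nonneg (hg.nonneg j a) (mul_nonneg hq0 (hD0 a))
        · simp [hg.eq_zero j a haj]
    have hA : 0 ≤ flagSum F [fun v => f v ^ 2] τ :=
      flagSum_nonneg hF _ (by simpa using fun v => sq_nonneg _) _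
    have hB : 0 ≤ flagSum F (g j :: L) τ := flagSum_nonneg hF _ (hg.map_nonneg (j :: J)) _
    have hmap : (j :: J).map g = g j :: L := rfl
    rw [hmap, List.length_cons]
    push_cast
    rw [add_one_mul, ← hC]
    set A := flagSum F [fun v => f v ^ 2] τ
    set B := flagSum F (g j :: L) τ
    have h5 := mul_le_mul_of_nonneg_left hsq hC0
    have h6 := mul_le_mul_of_nonneg_left hhsq he
    have h7 : 0 ≤ (n : ℝ) * (e * A) := by positivity
    have h8 : 0 ≤ e * B := by positivity
    linarith

/-- A quadratic polynomial in `t` that is nowhere negative has discriminant at most zero. Both signs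
of `t` are needed for the absolute value. -/
theorem abs_le_mul_sqrt_of_forall {x A B C : ℝ} (hC : 0 ≤ C)
    (h : ∀ t : ℝ, 2 * (t * x) ≤ C * (t ^ 2 * A + B)) : |x| ≤ C * √(A * B) := by
  have h1 := discrim_le_zero (a := C * A) (b := -2 * x) (c := C * B)
    (fun t => by linarith [h t])
  rw [discrim] at h1
  have h2 : |x| ≤ √(C ^ 2 * (A * B)) := Real.abs_le_sqrt (by linarith)
  rwa [Real.sqrt_mul (sq_nonneg C), Real.sqrt_sq hC] at h2

/-- Scaling `f` by every real `t` turns the additive bound of `two_mul_flagSum_cons_le` into a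
two-sided bound by a geometric mean. -/
theorem abs_flagSum_cons_le (hF : IsPartiteWeight n S F) {e : ℝ} (he : 0 ≤ e)
    (hpair : PairBound S F e) {g : Fin (n + 1) → V → ℝ} (hg : IsSideWeight S g)
    (J : List (Fin (n + 1))) (i : Fin (n + 1)) (f : V → ℝ) (hJ : (i :: J).Nodup)
    (hlen : J.length ≤ n) (hf : ∀ v, v ∉ S i → f v = 0) (hf0 : flagSum F [f] ∅ = 0) :
    |flagSum F (f :: J.map g) ∅| ≤ n * ((n + 1) * e) *
      √(flagSum F [fun v => f v ^ 2] ∅ * flagSum F (J.map g) ∅) := by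
  have hA : 0 ≤ flagSum F [fun v => f v ^ 2] ∅ :=
    flagSum_nonneg hF _ (by simpa using fun v => sq_nonneg _) _
  have hB : 0 ≤ flagSum F (J.map g) ∅ := flagSum_nonneg hF _ (hg.map_nonneg J) _
  refine abs_le_mul_sqrt_of_forall (by positivity) fun t => ?_
  have h1 := two_mul_flagSum_cons_le hF he hpair hg J i (fun v => t * f v) ∅ hJ (by simpa using hlen)
    (by simp) (fun v hv => by rw [hf v hv, mul_zero]) (by rw [flagSum_smul_cons, hf0, mul_zero])
  simp only [mul_pow, flagSum_smul_cons] at h1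
  refine h1.trans (mul_le_mul_of_nonneg_right ?_ (by positivity))
  exact mul_le_mul_of_nonneg_right (by exact_mod_cast hlen) (by positivity)

end flagSum

/-! ### The normalized mixing estimate. -/

section flagSum

variable {V : Type*} [Fintype V] [DecidableEq V] {n : ℕ} {S : Fin (n + 1) → Finset V}
  {F : Finset V → ℝ}

/-- The mean of the function `g` over the side `S i`. -/
noncomputable def sideMean (S : Fin (n + 1) → Finset V) (F : Finset V → ℝ) (g : Fin (n + 1) → V → ℝ)
    (i : Fin (n + 1)) : ℝ :=
  flagSum F [g i] ∅ / flagSum F [ind (S i)] ∅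

/-- The falling factorial `(n + 1) n ⋯ (n + 2 - r)`. -/
noncomputable def fallFactor (n r : ℕ) : ℝ := ∏ t ∈ Finset.range r, ((n : ℝ) + 1 - t)

theorem fallFactor_succ (n r : ℕ) : fallFactor n (r + 1) = fallFactor n r * ((n : ℝ) + 1 - r) :=
  Finset.prod_range_succ _ _

theorem one_le_fallFactor {n r : ℕ} (hr : r ≤ n + 1) : 1 ≤ fallFactor n r := by
  refine Finset.prod_induction _ (fun x : ℝ => 1 ≤ x)
    (fun a b => one_le_mul_of_one_le_of_one_le) le_rfl fun t ht => ?_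
  have : (t : ℝ) + 1 ≤ n + 1 := by
    exact_mod_cast (Nat.succ_le_of_lt (Finset.mem_range.1 ht)).trans hr
  linarith

theorem fallFactor_le {n r : ℕ} (hr : r ≤ n + 1) : fallFactor n r ≤ ((n : ℝ) + 1) ^ (n + 1) := by
  calc fallFactor n r ≤ ∏ _t ∈ Finset.range r, ((n : ℝ) + 1) := by
        refine Finset.prod_le_prod (fun t ht => ?_) fun t _ => ?_
        · have : (t : ℝ) + 1 ≤ n + 1 := by
            exact_mod_cast (Nat.succ_le_of_lt (Finset.mem_range.1 ht)).trans hr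
          linarith
        · linarith [Nat.cast_nonneg (α := ℝ) t]
    _ = ((n : ℝ) + 1) ^ r := by simp
    _ ≤ _ := pow_le_pow_right₀ (by linarith [Nat.cast_nonneg (α := ℝ) n]) hr

/-- The probability-normalized flag sum. -/
noncomputable def flagMean (F : Finset V → ℝ) (g : Fin (n + 1) → V → ℝ) (J : List (Fin (n + 1))) : ℝ :=
  fallFactor n J.length * flagSum F (J.map g) ∅ / F ∅

/-- The constant of the mixing estimate. -/
noncomputable def mixConst (n : ℕ) (e : ℝ) : ℝ := ((n : ℝ) + 1) ^ (n + 1) * (n * ((n + 1) * e))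

theorem mixConst_nonneg (n : ℕ) {e : ℝ} (he : 0 ≤ e) : 0 ≤ mixConst n e := by
  unfold mixConst; positivity

theorem flagSum_side (hF : IsPartiteWeight n S F) (i : Fin (n + 1)) :
    ((n : ℝ) + 1) * flagSum F [ind (S i)] ∅ = F ∅ := by
  simpa using side_weight_eq hF i ∅ (by simp) (by simp)

theorem flagSum_side_pos (hF : IsPartiteWeight n S F) (h0 : 0 < F ∅) (i : Fin (n + 1)) :
    0 < flagSum F [ind (S i)] ∅ := by
  have := flagSum_side hF i
  exact pos_of_mul_pos_right (this ▸ h0) (by positivity)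

theorem sideMean_mul (hF : IsPartiteWeight n S F) (h0 : 0 < F ∅) (g : Fin (n + 1) → V → ℝ)
    (i : Fin (n + 1)) : sideMean S F g i * flagSum F [ind (S i)] ∅ = flagSum F [g i] ∅ :=
  div_mul_cancel₀ _ (flagSum_side_pos hF h0 i).ne'

theorem sideMean_nonneg (hF : IsPartiteWeight n S F) {g : Fin (n + 1) → V → ℝ}
    (hg : IsSideWeight S g) (i : Fin (n + 1)) : 0 ≤ sideMean S F g i :=
  div_nonneg (flagSum_nonneg hF _ (by simpa using hg.nonneg i) _)
    (flagSum_nonneg hF _ (by simpa using ind_nonneg _) _)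

theorem sideMean_le_one (hF : IsPartiteWeight n S F) {g : Fin (n + 1) → V → ℝ}
    (hg : IsSideWeight S g) (i : Fin (n + 1)) : sideMean S F g i ≤ 1 := by
  refine div_le_one_of_le₀ (Finset.sum_le_sum fun u _ => ?_)
    (flagSum_nonneg hF _ (by simpa using ind_nonneg _) _)
  split_ifs
  · exact le_rfl
  · refine mul_le_mul_of_nonneg_right ?_ (hF.nonneg _)
    by_cases hu : u ∈ S i
    · rw [ind, if_pos hu]; exact hg.le_one i u
    · rw [hg.eq_zero i u hu]; exact ind_nonneg _ _

theorem flagSum_div_le_sideMean (hF : IsPartiteWeight n S F) (h0 : 0 < F ∅)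
    {g : Fin (n + 1) → V → ℝ} (hg : IsSideWeight S g) (i : Fin (n + 1)) (J : List (Fin (n + 1)))
    (hJ : J.length ≤ n) : flagSum F ((i :: J).map g) ∅ / F ∅ ≤ sideMean S F g i := by
  rw [div_le_iff₀ h0]
  calc flagSum F ((i :: J).map g) ∅ ≤ flagSum F [g i] ∅ :=
        flagSum_cons_le_singleton hF _ (hg.map_nonneg J) (hg.map_le_one J) _ (hg.nonneg i) _
          (by simpa using hJ)
    _ = sideMean S F g i * flagSum F [ind (S i)] ∅ := (sideMean_mul hF h0 g i).symm
    _ ≤ sideMean S F g i * F ∅ := by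
        refine mul_le_mul_of_nonneg_left ?_ (sideMean_nonneg hF hg i)
        exact flagSum_le hF _ (by simpa using ind_nonneg _) (by simpa using ind_le_one _) _ (by simp)

/-- Cost of replacing one function by its mean: the difference is the flag sum with the mean-zero
function `g i - p` on `S i`, since the constant function on `S i` integrates out exactly by
`flagSum_cons_side`. -/
theorem abs_flagMean_cons_sub_le (hF : IsPartiteWeight n S F) (h0 : 0 < F ∅) {e : ℝ} (he : 0 ≤ e)
    (hpair : PairBound S F e) {g : Fin (n + 1) → V → ℝ} (hg : IsSideWeight S g)
    (i : Fin (n + 1)) (J : List (Fin (n + 1))) (hJ : (i :: J).Nodup) :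
    |flagMean F g (i :: J) - sideMean S F g i * flagMean F g J|
      ≤ mixConst n e * √(sideMean S F g i * (flagSum F (J.map g) ∅ / F ∅)) := by
  have hlen : J.length + 1 ≤ n + 1 := by simpa using hJ.length_le_card
  have hlen' : J.length ≤ n := by omega
  set p := sideMean S F g i with hp
  have hp0 : 0 ≤ p := sideMean_nonneg hF hg i
  set s := flagSum F [ind (S i)] ∅ with hs
  have hs0 : 0 < s := flagSum_side_pos hF h0 i
  have hps : p * s = flagSum F [g i] ∅ := sideMean_mul hF h0 g i
  set f : V → ℝ := fun v => 1 * g i v + (-p) * ind (S i) v with hf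
  have hfS : ∀ v, v ∉ S i → f v = 0 := fun v hv => by
    simp only [hf, hg.eq_zero i v hv, ind_of_notMem hv]; ring
  have hf0 : flagSum F [f] ∅ = 0 := by
    rw [hf, flagSum_add_cons, ← hps, ← hs]; ring
  -- Variance of a function with values in `[0, 1]`: `g ^ 2 ≤ g` gives at most `p * (1 - p) * s`.
  have hsq : flagSum F [fun v => f v ^ 2] ∅ ≤ p * F ∅ := by
    calc flagSum F [fun v => f v ^ 2] ∅
        ≤ flagSum F [fun v => (1 - 2 * p) * g i v + p ^ 2 * ind (S i) v] ∅ := by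
          refine Finset.sum_le_sum fun v _ => ?_
          split_ifs
          · exact le_rfl
          · refine mul_le_mul_of_nonneg_right ?_ (hF.nonneg _)
            beta_reduce
            by_cases hv : v ∈ S i
            · simp only [hf, ind, if_pos hv]
              nlinarith [hg.nonneg i v, hg.le_one i v]
            · rw [hfS v hv, hg.eq_zero i v hv, ind_of_notMem hv]; simp
      _ = p * (s - p * s) := by rw [flagSum_add_cons, ← hps, ← hs]; ring
      _ ≤ p * F ∅ := by
          refine mul_le_mul_of_nonneg_left ?_ hp0
          have h1 : s ≤ F ∅ := flagSum_le hF _ (by simpa using ind_nonneg _)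
            (by simpa using ind_le_one _) _ (by simp)
          linarith [mul_nonneg hp0 hs0.le]
  have hside : ((n : ℝ) + 1 - J.length) * flagSum F (ind (S i) :: J.map g) ∅
      = flagSum F (J.map g) ∅ := by
    have := flagSum_cons_side hF i (J.map g) (fun k hk v hv => by
      obtain ⟨j, hj, rfl⟩ := List.mem_map.1 hk
      refine hg.eq_zero j v fun hvj => ?_
      have hij : i ≠ j := by
        rintro rfl
        exact (List.nodup_cons.1 hJ).1 hj
      exact Finset.disjoint_left.1 (hF.disjoint i j hij) hv hvj) ∅
      (by simp; omega) (by simp)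
    simpa using this
  have hB : 0 ≤ flagSum F (J.map g) ∅ := flagSum_nonneg hF _ (hg.map_nonneg J) _
  have hmain := abs_flagSum_cons_le hF he hpair hg J i f hJ hlen' hfS hf0
  have hexp : flagMean F g (i :: J) - p * flagMean F g J
      = fallFactor n (J.length + 1) / F ∅ * flagSum F (f :: J.map g) ∅ := by
    rw [hf, flagSum_add_cons, flagMean, flagMean, List.length_cons, List.map_cons, ← hside,
      fallFactor_succ]
    ring
  rw [hexp, abs_mul, abs_of_nonneg (div_nonneg
    (zero_le_one.trans (one_le_fallFactor hlen)) h0.le)]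
  have hsqrt : √(flagSum F [fun v => f v ^ 2] ∅ * flagSum F (J.map g) ∅)
      ≤ F ∅ * √(p * (flagSum F (J.map g) ∅ / F ∅)) := by
    rw [← Real.sqrt_sq h0.le, ← Real.sqrt_mul (sq_nonneg (F ∅)), Real.sqrt_sq h0.le]
    refine Real.sqrt_le_sqrt ((mul_le_mul_of_nonneg_right hsq hB).trans (le_of_eq ?_))
    field_simp
  calc fallFactor n (J.length + 1) / F ∅ * |flagSum F (f :: J.map g) ∅|
      ≤ fallFactor n (J.length + 1) / F ∅ * (n * ((n + 1) * e)
          * (F ∅ * √(p * (flagSum F (J.map g) ∅ / F ∅)))) := by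
        refine mul_le_mul_of_nonneg_left (hmain.trans ?_) (div_nonneg
          (zero_le_one.trans (one_le_fallFactor hlen)) h0.le)
        exact mul_le_mul_of_nonneg_left hsqrt (by positivity)
    _ = fallFactor n (J.length + 1) * ((n * ((n + 1) * e))
          * √(p * (flagSum F (J.map g) ∅ / F ∅))) := by field_simp
    _ ≤ ((n : ℝ) + 1) ^ (n + 1) * ((n * ((n + 1) * e))
          * √(p * (flagSum F (J.map g) ∅ / F ∅))) :=
        mul_le_mul_of_nonneg_right (fallFactor_le hlen) (by positivity)
    _ = _ := by rw [mixConst]; ring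

/-- Telescoping: each replacement costs at most `mixConst n e`, and the densities already split off
are at most `1`. -/
theorem abs_flagMean_sub_prod_le (hF : IsPartiteWeight n S F) (h0 : 0 < F ∅) {e : ℝ} (he : 0 ≤ e)
    (hpair : PairBound S F e) {g : Fin (n + 1) → V → ℝ} (hg : IsSideWeight S g)
    (J : List (Fin (n + 1))) (hJ : J.Nodup) :
    |flagMean F g J - (J.map (sideMean S F g)).prod| ≤ J.length * mixConst n e := by
  induction J with
  | nil => simp [flagMean, fallFactor, flagSum_nil, h0.ne']
  | cons i J ih =>
    have hlen : J.length + 1 ≤ n + 1 := by simpa using hJ.length_le_card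
    have hK := mixConst_nonneg n he
    have hp0 := sideMean_nonneg hF hg i
    have hp1 := sideMean_le_one hF hg i
    have h1 := abs_flagMean_cons_sub_le hF h0 he hpair hg i J hJ
    have hq1 : flagSum F (J.map g) ∅ / F ∅ ≤ 1 := div_le_one_of_le₀
      (flagSum_le hF _ (hg.map_nonneg J) (hg.map_le_one J) _ (by simp; omega)) h0.le
    have hq0 : 0 ≤ flagSum F (J.map g) ∅ / F ∅ :=
      div_nonneg (flagSum_nonneg hF _ (hg.map_nonneg J) _) h0.le
    have h2 : √(sideMean S F g i * (flagSum F (J.map g) ∅ / F ∅)) ≤ 1 :=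
      Real.sqrt_le_one.2 (mul_le_one₀ hp1 hq0 hq1)
    have h3 := ih (List.nodup_cons.1 hJ).2
    rw [List.map_cons, List.prod_cons, List.length_cons]
    calc |flagMean F g (i :: J) - sideMean S F g i * (J.map (sideMean S F g)).prod|
        ≤ |flagMean F g (i :: J) - sideMean S F g i * flagMean F g J|
          + sideMean S F g i * |flagMean F g J - (J.map (sideMean S F g)).prod| := by
          rw [← abs_of_nonneg hp0, ← abs_mul, abs_of_nonneg hp0, mul_sub]
          exact abs_sub_le _ _ _
      _ ≤ mixConst n e * 1 + 1 * (J.length * mixConst n e) :=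
          add_le_add (h1.trans (mul_le_mul_of_nonneg_left h2 hK))
            (mul_le_mul hp1 h3 (abs_nonneg _) zero_le_one)
      _ = _ := by push_cast; ring

/-- In the telescoping sum, the first error carries `√(p * r)` because the remaining flag sum still
contains the factor of `j`. The second carries `p * √r ≤ √(p * r)`, and all later ones carry `p * r
≤ √(p * r)`. -/
theorem abs_flagMean_sub_prod_le_sqrt_cons (hF : IsPartiteWeight n S F) (h0 : 0 < F ∅) {e : ℝ}
    (he : 0 ≤ e) (hpair : PairBound S F e) {g : Fin (n + 1) → V → ℝ} (hg : IsSideWeight S g)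
    (i j : Fin (n + 1)) (J : List (Fin (n + 1))) (hJ : (i :: j :: J).Nodup) :
    |flagMean F g (i :: j :: J) - ((i :: j :: J).map (sideMean S F g)).prod|
      ≤ (i :: j :: J).length * mixConst n e * √(sideMean S F g i * sideMean S F g j) := by
  have hlen : J.length + 1 + 1 ≤ n + 1 := by simpa using hJ.length_le_card
  have hK := mixConst_nonneg n he
  have hp0 := sideMean_nonneg hF hg i
  have hp1 := sideMean_le_one hF hg i
  have hr0 := sideMean_nonneg hF hg j
  have hr1 := sideMean_le_one hF hg j
  have hJ' := (List.nodup_cons.1 hJ).2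
  have h1 := abs_flagMean_cons_sub_le hF h0 he hpair hg i (j :: J) hJ
  have h2 := abs_flagMean_cons_sub_le hF h0 he hpair hg j J hJ'
  have h3 := abs_flagMean_sub_prod_le hF h0 he hpair hg J (List.nodup_cons.1 hJ').2
  have hq1 : flagSum F (J.map g) ∅ / F ∅ ≤ 1 := div_le_one_of_le₀
    (flagSum_le hF _ (hg.map_nonneg J) (hg.map_le_one J) _ (by simp; omega)) h0.le
  have hqj := flagSum_div_le_sideMean hF h0 hg j J (by omega)
  have h1' : √(sideMean S F g i * (flagSum F ((j :: J).map g) ∅ / F ∅))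
      ≤ √(sideMean S F g i * sideMean S F g j) :=
    Real.sqrt_le_sqrt (mul_le_mul_of_nonneg_left hqj hp0)
  have h2' : √(sideMean S F g j * (flagSum F (J.map g) ∅ / F ∅)) ≤ √(sideMean S F g j) :=
    Real.sqrt_le_sqrt (mul_le_of_le_one_right hr0 hq1)
  rw [List.map_cons, List.prod_cons, List.map_cons, List.prod_cons, List.length_cons,
    List.length_cons]
  set p := sideMean S F g i
  set r := sideMean S F g j
  set Q := (J.map (sideMean S F g)).prod
  set R := √(p * r) with hR
  have hR1 : R ≤ 1 := Real.sqrt_le_one.2 (mul_le_one₀ hp1 hr0 hr1)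
  have hpr : p * r ≤ R := by
    have h : R * R = p * r := Real.mul_self_sqrt (mul_nonneg hp0 hr0)
    rw [← h]
    exact mul_le_of_le_one_left (Real.sqrt_nonneg _) hR1
  have hpsqrt : p * √r ≤ R := by
    rw [hR, Real.sqrt_mul hp0]
    refine mul_le_mul_of_nonneg_right ?_ (Real.sqrt_nonneg _)
    exact Real.le_sqrt_of_sq_le (by nlinarith)
  calc |flagMean F g (i :: j :: J) - p * (r * Q)|
      = |(flagMean F g (i :: j :: J) - p * flagMean F g (j :: J))
        + p * (flagMean F g (j :: J) - r * flagMean F g J) + p * r * (flagMean F g J - Q)| := by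
        congr 1; ring
    _ ≤ |flagMean F g (i :: j :: J) - p * flagMean F g (j :: J)|
        + p * |flagMean F g (j :: J) - r * flagMean F g J| + p * r * |flagMean F g J - Q| := by
        refine (abs_add_three _ _ _).trans ?_
        rw [abs_mul p, abs_mul (p * r), abs_of_nonneg hp0, abs_of_nonneg (mul_nonneg hp0 hr0)]
    _ ≤ mixConst n e * R + p * (mixConst n e * √r) + p * r * (J.length * mixConst n e) :=
        add_le_add (add_le_add (h1.trans (mul_le_mul_of_nonneg_left h1' hK))
          (mul_le_mul_of_nonneg_left (h2.trans (mul_le_mul_of_nonneg_left h2' hK)) hp0))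
          (mul_le_mul_of_nonneg_left h3 (mul_nonneg hp0 hr0))
    _ ≤ mixConst n e * R + mixConst n e * R + R * (J.length * mixConst n e) := by
        refine add_le_add (add_le_add le_rfl ?_) (mul_le_mul_of_nonneg_right hpr (by positivity))
        calc p * (mixConst n e * √r) = mixConst n e * (p * √r) := by ring
          _ ≤ _ := mul_le_mul_of_nonneg_left hpsqrt hK
    _ = _ := by push_cast; ring

/-- Mixing in a partite weight: the flag mean is close to the product of the side means. -/
theorem abs_flagMean_sub_prod_le_sqrt (hF : IsPartiteWeight n S F) (h0 : 0 < F ∅) {e : ℝ}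
    (he : 0 ≤ e) (hpair : PairBound S F e) {g : Fin (n + 1) → V → ℝ} (hg : IsSideWeight S g)
    (J : List (Fin (n + 1))) (hJ : J.Nodup) (i j : Fin (n + 1)) (hi : i ∈ J) (hj : j ∈ J)
    (hij : i ≠ j) :
    |flagMean F g J - (J.map (sideMean S F g)).prod|
      ≤ J.length * mixConst n e * √(sideMean S F g i * sideMean S F g j) := by
  -- Flag sums do not depend on the order of the sides, so `i` and `j` may be moved to the front.
  have hperm : J.Perm (i :: j :: (J.erase i).erase j) :=
    (List.perm_cons_erase hi).trans
      ((List.perm_cons_erase ((List.mem_erase_of_ne hij.symm).2 hj)).cons i)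
  have h := abs_flagMean_sub_prod_le_sqrt_cons hF h0 he hpair hg i j _ (hperm.nodup_iff.1 hJ)
  rw [← (hperm.map _).prod_eq, ← hperm.length_eq] at h
  rwa [flagMean, hperm.length_eq, flagSum_perm (hperm.map g), ← flagMean, ← hperm.length_eq]

/-- The pair bound of a partite weight whose one-dimensional links have spectral gap `lam`. -/
theorem pairBound_of_hasGap (hF : IsPartiteWeight n S F)
    (hconn : ∀ τ : Finset V, τ.card + 1 ≤ n → EdgeConnected (linkEdge F τ)) (lam : ℝ)
    (hlam : n * (1 - lam) < 1)
    (hbase : ∀ τ : Finset V, τ.card + 1 = n → HasGap (linkEdge F τ) lam) :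
    PairBound S F (|1 - lam| / (1 - (n - 1) * (1 - lam))) := by
  intro τ i j f h hτ hij hj hf hh hf0
  -- When `lam ≤ 1`, the worst value is `t = n - 1`, the link of the empty face; it gives the
  -- constant. When `lam ≥ 1`, the gap of every link is at least `1`.
  obtain ⟨t, ht⟩ : ∃ t, τ.card + (t + 1) = n := ⟨n - τ.card - 1, by omega⟩
  have htn : (t : ℝ) ≤ n - 1 := by
    have : (t : ℝ) + 1 ≤ n := by exact_mod_cast (by omega : t + 1 ≤ n)
    linarith
  have ht0 : (0 : ℝ) ≤ t := Nat.cast_nonneg t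
  have hpos : 0 < 1 - ((n : ℝ) - 1) * (1 - lam) := by
    rcases le_total (1 - lam) 0 with h | h
    · nlinarith
    · nlinarith
  refine two_mul_flagSum_pair_le hF τ hτ _ _ (hasGap_linkEdge hF hconn (1 - lam) hlam
    (fun σ hσ => by rw [sub_sub_cancel]; exact hbase σ hσ) t τ ht)
    (div_nonneg (abs_nonneg _) hpos.le) ?_ i j hij hj f h hf hh hf0
  rw [sub_sub_cancel]
  rcases le_total (1 - lam) 0 with h | h
  · refine (div_nonpos_of_nonpos_of_nonneg h ?_).trans (div_nonneg (abs_nonneg _) hpos.le)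
    nlinarith
  · rw [abs_of_nonneg h]
    refine div_le_div_of_nonneg_left h hpos ?_
    nlinarith

end flagSum

/-! ### From simplicial complexes to partite weights. -/

namespace PreAbstractSimplicialComplex

section

variable {V : Type*} [Fintype V] [DecidableEq V] {X : PreAbstractSimplicialComplex V}
  {m : Finset V → ℝ} {n : ℕ} {S : Fin (n + 1) → Finset V}

theorem mem_of_subset {V : Type*} {X : PreAbstractSimplicialComplex V} {σ τ : Finset V} (hσ : σ ∈ X)
    (h : τ ⊆ σ) (hne : τ.Nonempty) : τ ∈ X :=
  (X.isRelLowerSet_faces hσ).2 h hne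

theorem IsSimplex.mono {V : Type*} {X : PreAbstractSimplicialComplex V} {σ τ : Finset V}
    (hσ : X.IsSimplex σ) (h : τ ⊆ σ) : X.IsSimplex τ := by
  rcases τ.eq_empty_or_nonempty with h0 | h0
  · exact Or.inl h0
  · rcases hσ with rfl | hσ
    · exact Or.inl (Finset.subset_empty.1 h)
    · exact Or.inr (mem_of_subset hσ h h0)

theorem isSimplex_iff_mem {V : Type*} {X : PreAbstractSimplicialComplex V} {τ : Finset V}
    (h : τ.Nonempty) : X.IsSimplex τ ↔ τ ∈ X :=
  ⟨fun hτ => hτ.resolve_left h.ne_empty, Or.inr⟩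

open Classical in
/-- The weight `m`, extended by zero to all finite sets of vertices. -/
noncomputable def faceWeight {V : Type*} (X : PreAbstractSimplicialComplex V) (m : Finset V → ℝ) (τ : Finset V) :
    ℝ :=
  if X.IsSimplex τ then m τ else 0

theorem faceWeight_of_isSimplex {V : Type*} {X : PreAbstractSimplicialComplex V}
    {m : Finset V → ℝ} {τ : Finset V} (h : X.IsSimplex τ) : X.faceWeight m τ = m τ :=
  if_pos h

theorem faceWeight_of_not_isSimplex {V : Type*} {X : PreAbstractSimplicialComplex V}
    {m : Finset V → ℝ} {τ : Finset V} (h : ¬X.IsSimplex τ) : X.faceWeight m τ = 0 :=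
  if_neg h

theorem faceWeight_pos_iff {V : Type*} [Fintype V] {X : PreAbstractSimplicialComplex V}
    {m : Finset V → ℝ} {n : ℕ} (hm : X.IsWeight n m) {τ : Finset V} :
    0 < X.faceWeight m τ ↔ X.IsSimplex τ := by
  by_cases h : X.IsSimplex τ
  · rw [faceWeight_of_isSimplex h]
    exact iff_of_true (hm.pos τ h) h
  · rw [faceWeight_of_not_isSimplex h]
    exact iff_of_false (lt_irrefl _) h

theorem faceWeight_nonneg {V : Type*} [Fintype V] {X : PreAbstractSimplicialComplex V}
    {m : Finset V → ℝ} {n : ℕ} (hm : X.IsWeight n m) (τ : Finset V) : 0 ≤ X.faceWeight m τ := by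
  by_cases h : X.IsSimplex τ
  · exact ((faceWeight_pos_iff hm).2 h).le
  · rw [faceWeight_of_not_isSimplex h]

theorem faceWeight_eq_zero_iff {V : Type*} [Fintype V] {X : PreAbstractSimplicialComplex V}
    {m : Finset V → ℝ} {n : ℕ} (hm : X.IsWeight n m) {τ : Finset V} :
    X.faceWeight m τ = 0 ↔ ¬X.IsSimplex τ := by
  rw [← faceWeight_pos_iff hm, not_lt]
  exact ⟨le_of_eq, fun h => le_antisymm h (faceWeight_nonneg hm τ)⟩

theorem isPartiteWeight_faceWeight (hm : X.IsWeight n m) (hS : X.IsPartite n S) :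
    IsPartiteWeight n S (X.faceWeight m) where
  nonneg := faceWeight_nonneg hm
  insert_eq_zero τ u h := by
    rw [faceWeight_eq_zero_iff hm] at h ⊢
    exact fun h' => h (h'.mono (Finset.subset_insert u τ))
  sum_insert τ hτ := by
    classical
    by_cases h : X.IsSimplex τ
    · have hsum : ∑ σ ∈ Finset.univ.filter (fun σ => σ ∈ X ∧ τ ⊆ σ ∧ σ.card = τ.card + 1), m σ
          = m τ := by convert hm.sum_eq τ h hτ
      rw [faceWeight_of_isSimplex h, ← hsum]
      have h1 : ∀ u, (if u ∈ τ then 0 else X.faceWeight m (insert u τ))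
          = if u ∉ τ ∧ insert u τ ∈ X then m (insert u τ) else 0 := by
        intro u
        by_cases hu : u ∈ τ
        · simp [hu]
        · by_cases hX : insert u τ ∈ X
          · rw [if_neg hu, if_pos ⟨hu, hX⟩, faceWeight_of_isSimplex (Or.inr hX)]
          · rw [if_neg hu, if_neg fun h => hX h.2, faceWeight_of_not_isSimplex]
            rwa [isSimplex_iff_mem (Finset.insert_nonempty u τ)]
      rw [Finset.sum_congr rfl fun u _ => h1 u, ← Finset.sum_filter]
      -- Cofaces of `τ` one dimension higher correspond to the single vertex they add.
      refine Finset.sum_bij (fun u _ => insert u τ) ?_ ?_ ?_ fun _ _ => rfl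
      · intro u hu
        obtain ⟨hu1, hu2⟩ := (Finset.mem_filter.1 hu).2
        exact Finset.mem_filter.2 ⟨Finset.mem_univ _, hu2, Finset.subset_insert u τ,
          Finset.card_insert_of_notMem hu1⟩
      · intro u hu v hv huv
        have hu1 := (Finset.mem_filter.1 hu).2.1
        have : u ∈ insert v τ := by
          rw [← show insert u τ = insert v τ from huv]; exact Finset.mem_insert_self u τ
        exact (Finset.mem_insert.1 this).resolve_right hu1
      · intro σ hσ
        obtain ⟨hσX, hτσ, hc⟩ := (Finset.mem_filter.1 hσ).2
        obtain ⟨u, hu⟩ := Finset.card_eq_one.1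
          (show (σ \ τ).card = 1 by rw [Finset.card_sdiff_of_subset hτσ, hc]; omega)
        have hmem : u ∈ σ \ τ := by rw [hu]; exact Finset.mem_singleton_self u
        have hσe : insert u τ = σ := by
          rw [Finset.insert_eq, ← hu, Finset.sdiff_union_of_subset hτσ]
        exact ⟨u, Finset.mem_filter.2 ⟨Finset.mem_univ _, (Finset.mem_sdiff.1 hmem).2,
          hσe ▸ hσX⟩, hσe⟩
    · rw [faceWeight_of_not_isSimplex h]
      refine Finset.sum_eq_zero fun u _ => ?_
      rw [faceWeight_of_not_isSimplex fun h' => h (h'.mono (Finset.subset_insert u τ)), ite_self]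
  eq_zero_of_side τ i u v hu hv huv hui hvi := by
    rw [faceWeight_eq_zero_iff hm]
    intro h
    have he : {u, v} ∈ X := (isSimplex_iff_mem ⟨u, by simp⟩).1
      (h.mono (Finset.insert_subset hu (Finset.singleton_subset_iff.2 hv)))
    obtain ⟨a, b, hab, hua, hvb⟩ := hS.edge u v huv he
    have h1 : ∀ (w : V) (a b : Fin (n + 1)), w ∈ S a → w ∈ S b → a = b := by
      intro w a b ha hb
      by_contra hne
      exact Finset.disjoint_left.1 (hS.disjoint a b hne) ha hb
    exact hab ((h1 u a i hua hui).trans (h1 v b i hvb hvi).symm)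
  exists_side τ u hτ hu := by
    have h : X.IsSimplex τ := by
      by_contra h
      exact hτ (faceWeight_of_not_isSimplex h)
    exact (hS.cover u).1 ((isSimplex_iff_mem (Finset.singleton_nonempty u)).1
      (h.mono (Finset.singleton_subset_iff.2 hu)))
  disjoint := hS.disjoint

theorem singleton_mem_link_iff {V : Type*} [DecidableEq V] {X : PreAbstractSimplicialComplex V}
    {τ : Finset V} {u : V} :
    {u} ∈ X.link τ ↔ u ∉ τ ∧ insert u τ ∈ X := by
  have : {u} ∈ X.link τ ↔ ({u} : Finset V).Nonempty ∧ Disjoint τ {u} ∧ τ ∪ {u} ∈ X := Iff.rfl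
  rw [this, Finset.disjoint_singleton_right, Finset.union_comm, ← Finset.insert_eq]
  simp

theorem pair_mem_link_iff {V : Type*} [DecidableEq V] {X : PreAbstractSimplicialComplex V}
    {τ : Finset V} {u v : V} :
    {u, v} ∈ X.link τ ↔ u ∉ τ ∧ v ∉ τ ∧ insert u (insert v τ) ∈ X := by
  have : {u, v} ∈ X.link τ ↔ ({u, v} : Finset V).Nonempty ∧ Disjoint τ {u, v} ∧ τ ∪ {u, v} ∈ X :=
    Iff.rfl
  have hU : τ ∪ {u, v} = insert u (insert v τ) := by
    ext; simp only [Finset.mem_union, Finset.mem_insert, Finset.mem_singleton]; tauto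
  rw [this, hU, Finset.disjoint_insert_right, Finset.disjoint_singleton_right]
  simp [and_assoc]

theorem linkEdge_pos_iff (hm : X.IsWeight n m) {τ : Finset V} {u v : V} :
    0 < linkEdge (X.faceWeight m) τ u v ↔ u ≠ v ∧ {u, v} ∈ X.link τ := by
  rw [pair_mem_link_iff, linkEdge]
  split_ifs with h
  · refine iff_of_false (lt_irrefl _) ?_
    tauto
  · rw [faceWeight_pos_iff hm, isSimplex_iff_mem (Finset.insert_nonempty _ _)]
    tauto

theorem sum_linkEdge_pos_iff (hm : X.IsWeight n m) (hS : X.IsPartite n S) {τ : Finset V}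
    (hτ : τ.card + 1 ≤ n) {u : V} :
    0 < ∑ v, linkEdge (X.faceWeight m) τ u v ↔ {u} ∈ X.link τ := by
  rw [sum_linkEdge (isPartiteWeight_faceWeight hm hS) τ hτ, singleton_mem_link_iff]
  split_ifs with h
  · exact iff_of_false (lt_irrefl _) fun h' => h'.1 h
  · rw [faceWeight_pos_iff hm, isSimplex_iff_mem (Finset.insert_nonempty _ _)]
    tauto

theorem edgeConnected_linkEdge (hm : X.IsWeight n m) (hS : X.IsPartite n S)
    (hX : X.LinksConnected n) (τ : Finset V) (hτ : τ.card + 1 ≤ n) :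
    EdgeConnected (linkEdge (X.faceWeight m) τ) := by
  intro φ hφ u v hu hv
  rw [sum_linkEdge_pos_iff hm hS hτ] at hu hv
  have hτX : X.IsSimplex τ := IsSimplex.mono (Or.inr (singleton_mem_link_iff.1 hu).2)
    (Finset.subset_insert u τ)
  obtain ⟨p⟩ := (hX τ hτX (by omega)).preconnected ⟨u, hu⟩ ⟨v, hv⟩
  have key : ∀ a b : (X.link τ).Vert, (X.link τ).oneSkeleton.Walk a b → φ a.1 = φ b.1 := by
    intro a b p
    induction p with
    | nil => rfl
    | cons hadj _ ih =>
      refine (hφ _ _ ((linkEdge_pos_iff hm).2 ⟨?_, hadj.2⟩)).trans ih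
      exact fun h => hadj.1 (Subtype.ext h)
  exact key _ _ p

/-- Multiplying by the vertex weight makes the Laplacian symmetric and brings it to the form used in
`hasGap_of_eigenvalues`. -/
theorem upperLaplacian_link_apply (hm : X.IsWeight n m) {τ : Finset V}
    (ψ : V → ℝ) (u : (X.link τ).Vert) :
    m (insert u.1 τ) * (X.link τ).upperLaplacian (linkWeight m τ) (fun v => ψ v.1) u
      = ∑ v, linkEdge (X.faceWeight m) τ u.1 v * (ψ u.1 - ψ v) := by
  classical
  obtain ⟨hu, huX⟩ := singleton_mem_link_iff.1 u.2
  have hpos := hm.pos _ (Or.inr huX)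
  have hU : τ ∪ {u.1} = insert u.1 τ := by rw [Finset.union_comm, Finset.insert_eq]
  have h1 : (X.link τ).upperLaplacian (linkWeight m τ) (fun v => ψ v.1) u
      = ∑ v ∈ Finset.univ.filter (fun v => (X.link τ).oneSkeleton.Adj v u),
        linkWeight m τ {v.1, u.1} / linkWeight m τ {u.1} * (ψ u.1 - ψ v.1) := by
    simp only [upperLaplacian, delta0, d0, LinearMap.comp_apply, LinearMap.coe_mk, AddHom.coe_mk]
  rw [h1, Finset.mul_sum]
  have h2 : ∑ v, linkEdge (X.faceWeight m) τ u.1 v * (ψ u.1 - ψ v)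
      = ∑ v ∈ Finset.univ.filter (fun v => u.1 ≠ v ∧ {u.1, v} ∈ X.link τ),
        linkEdge (X.faceWeight m) τ u.1 v * (ψ u.1 - ψ v) := by
    refine (Finset.sum_filter_of_ne fun v _ hv => ?_).symm
    rw [← linkEdge_pos_iff hm]
    refine lt_of_le_of_ne ?_ (Ne.symm (left_ne_zero_of_mul hv))
    rw [linkEdge]
    split_ifs
    · exact le_rfl
    · exact faceWeight_nonneg hm _
  rw [h2]
  refine Finset.sum_bij (fun v _ => v.1) ?_ ?_ ?_ ?_
  · intro v hv
    have hadj := (Finset.mem_filter.1 hv).2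
    refine Finset.mem_filter.2 ⟨Finset.mem_univ _, fun h => hadj.1 (Subtype.ext h.symm), ?_⟩
    rw [Finset.pair_comm]
    exact hadj.2
  · exact fun v _ w _ h => Subtype.ext h
  · intro v hv
    obtain ⟨huv, hX⟩ := (Finset.mem_filter.1 hv).2
    refine ⟨⟨v, mem_of_subset hX (by simp) (Finset.singleton_nonempty v)⟩,
      Finset.mem_filter.2 ⟨Finset.mem_univ _, fun h => huv (congrArg Subtype.val h).symm, ?_⟩, rfl⟩
    rw [Finset.pair_comm]
    exact hX
  · intro v hv
    have hadj := (Finset.mem_filter.1 hv).2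
    have hne : u.1 ≠ v.1 := fun h => hadj.1 (Subtype.ext h.symm)
    have hX : {u.1, v.1} ∈ X.link τ := by rw [Finset.pair_comm]; exact hadj.2
    obtain ⟨-, hv', hXuv⟩ := pair_mem_link_iff.1 hX
    have hP : τ ∪ {v.1, u.1} = insert u.1 (insert v.1 τ) := by
      ext; simp only [Finset.mem_union, Finset.mem_insert, Finset.mem_singleton]; tauto
    rw [linkWeight, linkWeight, hU, hP, linkEdge, if_neg (by tauto),
      faceWeight_of_isSimplex (Or.inr hXuv)]
    field_simp

theorem hasGap_linkEdge_of_spectrum (hm : X.IsWeight n m) (hS : X.IsPartite n S) {lam : ℝ}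
    (hX : X.LocalSpectralExpansion n m lam) (τ : Finset V) (hτ : τ.card + 1 = n) :
    HasGap (linkEdge (X.faceWeight m) τ) lam := by
  have hF := isPartiteWeight_faceWeight hm hS
  refine hasGap_of_eigenvalues _ (linkEdge_comm _ τ) (linkEdge_nonneg hF τ)
    (edgeConnected_linkEdge hm hS hX.linksConnected τ hτ.le) lam fun μ ψ hμ heig hpos => ?_
  -- Positive norm yields a vertex of the link at which `ψ` does not vanish. Hence `τ` is a simplex
  -- and the restriction of `ψ` to the link is a non-zero eigenvector.
  obtain ⟨u₀, -, hu₀⟩ := Finset.exists_ne_zero_of_sum_ne_zero hpos.ne'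
  have hw₀ : 0 < ∑ v, linkEdge (X.faceWeight m) τ u₀ v :=
    lt_of_le_of_ne (Finset.sum_nonneg fun v _ => linkEdge_nonneg hF τ u₀ v)
      (Ne.symm (left_ne_zero_of_mul hu₀))
  have hψ₀ : ψ u₀ ≠ 0 := fun h => hu₀ (by rw [h]; ring)
  have hmem₀ := (sum_linkEdge_pos_iff hm hS hτ.le).1 hw₀
  have hτX : X.IsSimplex τ := IsSimplex.mono (Or.inr (singleton_mem_link_iff.1 hmem₀).2)
    (Finset.subset_insert u₀ τ)
  refine hX.spectrum_subset τ hτX hτ ⟨Module.End.HasEigenvalue.mem_spectrum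
    (Module.End.hasEigenvalue_of_hasEigenvector (x := fun v => ψ v.1)
      ⟨Module.End.mem_eigenspace_iff.2 ?_, fun h => hψ₀ (congrFun h ⟨u₀, hmem₀⟩)⟩), hμ⟩
  funext u
  obtain ⟨hu, huX⟩ := singleton_mem_link_iff.1 u.2
  have hmpos := hm.pos _ (Or.inr huX)
  refine mul_left_cancel₀ hmpos.ne' ?_
  rw [upperLaplacian_link_apply hm]
  have h := heig u.1
  rw [sum_linkEdge hF τ hτ.le, if_neg hu, faceWeight_of_isSimplex (Or.inr huX)] at h
  simp only [mul_sub, Finset.sum_sub_distrib, ← Finset.sum_mul]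
  rw [sum_linkEdge hF τ hτ.le, if_neg hu, faceWeight_of_isSimplex (Or.inr huX), h, Pi.smul_apply,
    smul_eq_mul]
  ring

theorem flagSum_ofFn_ind (F : Finset V → ℝ) {k : ℕ} (U : Fin k → Finset V) (τ : Finset V)
    (hU : ∀ i j, i ≠ j → Disjoint (U i) (U j)) (hτ : ∀ i, Disjoint τ (U i)) :
    flagSum F (List.ofFn fun i => ind (U i)) τ
      = ∑ u ∈ Fintype.piFinset U, F (τ ∪ Finset.univ.image u) := by
  induction k generalizing τ with
  | zero => simp [flagSum_nil, Fintype.piFinset_of_isEmpty]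
  | succ k ih =>
    rw [List.ofFn_succ, flagSum_cons]
    have h1 : ∀ a, (if a ∈ τ then 0 else ind (U 0) a *
        flagSum F (List.ofFn fun i : Fin k => ind (U i.succ)) (insert a τ))
        = if a ∈ U 0 then ∑ u ∈ Fintype.piFinset fun i : Fin k => U i.succ,
          F (insert a τ ∪ Finset.univ.image u) else 0 := by
      intro a
      by_cases ha : a ∈ U 0
      · rw [if_neg fun h => Finset.disjoint_left.1 (hτ 0) h ha, if_pos ha, ind, if_pos ha, one_mul,
          ih (fun i => U i.succ) (insert a τ) (fun i j hij => hU _ _ fun h =>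
            hij (Fin.succ_injective _ h)) fun i => ?_]
        rw [Finset.disjoint_insert_left]
        exact ⟨fun h => Finset.disjoint_left.1 (hU 0 i.succ (Fin.succ_ne_zero i).symm) ha h,
          hτ i.succ⟩
      · rw [if_neg ha, ind_of_notMem ha, zero_mul, ite_self]
    rw [Finset.sum_congr rfl fun a _ => h1 a, Finset.sum_ite_mem, Finset.univ_inter,
      ← Finset.sum_product']
    refine Finset.sum_nbij' (fun p : V × (Fin k → V) => (Fin.cons p.1 p.2 : Fin (k + 1) → V))
      (fun u : Fin (k + 1) → V => (u 0, fun i : Fin k => u i.succ)) ?_ ?_ ?_ ?_ ?_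
    · intro p hp
      rw [Finset.mem_product, Fintype.mem_piFinset] at hp
      rw [Fintype.mem_piFinset]
      intro i
      refine Fin.cases ?_ (fun i => ?_) i
      · simpa using hp.1
      · simpa using hp.2 i
    · intro u hu
      rw [Fintype.mem_piFinset] at hu
      rw [Finset.mem_product, Fintype.mem_piFinset]
      exact ⟨hu 0, fun i => hu i.succ⟩
    · intro p _
      simp
    · intro u _
      exact Fin.cons_self_tail u
    · intro p _
      congr 1
      ext x
      simp only [Finset.mem_union, Finset.mem_insert, Finset.mem_image, Finset.mem_univ, true_and,
        Fin.exists_fin_succ, Fin.cons_zero, Fin.cons_succ]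
      rw [eq_comm (a := x)]
      tauto

/-- By disjointness a simplex meets each `U i` in exactly one vertex, so it comes from a single
tuple and is counted once. -/
theorem mixedWeight_eq_flagSum {l : ℕ} (U : Fin (l + 1) → Finset V)
    (hU : ∀ i j, i ≠ j → Disjoint (U i) (U j)) :
    X.mixedWeight m U = flagSum (X.faceWeight m) (List.ofFn fun i => ind (U i)) ∅ := by
  classical
  rw [flagSum_ofFn_ind _ U ∅ hU fun i => Finset.disjoint_empty_left _]
  have hinj : ∀ u ∈ Fintype.piFinset U, Function.Injective u := by
    intro u hu i j hij
    rw [Fintype.mem_piFinset] at hu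
    by_contra hne
    exact Finset.disjoint_left.1 (hU i j hne) (hu i) (hij ▸ hu j)
  have h1 : ∑ u ∈ Fintype.piFinset U, X.faceWeight m (∅ ∪ Finset.univ.image u)
      = ∑ u ∈ (Fintype.piFinset U).filter (fun u => Finset.univ.image u ∈ X),
        m (Finset.univ.image u) := by
    rw [Finset.sum_filter]
    refine Finset.sum_congr rfl fun u _ => ?_
    rw [Finset.empty_union]
    split_ifs with h
    · exact faceWeight_of_isSimplex (Or.inr h)
    · refine faceWeight_of_not_isSimplex ?_
      rwa [isSimplex_iff_mem (Finset.univ_nonempty.image u)]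
  have hmix : X.mixedWeight m U = ∑ σ ∈ Finset.univ.filter (fun σ : Finset V => σ ∈ X ∧
      σ.card = l + 1 ∧ ∃ u : Fin (l + 1) → V, (∀ i, u i ∈ U i) ∧ σ = Finset.univ.image u), m σ := by
    unfold mixedWeight
    congr!
  rw [h1, hmix]
  symm
  refine Finset.sum_bij (fun u _ => Finset.univ.image u) ?_ ?_ ?_ fun _ _ => rfl
  · intro u hu
    obtain ⟨hu, hX⟩ := Finset.mem_filter.1 hu
    refine Finset.mem_filter.2 ⟨Finset.mem_univ _, hX, ?_, u, Fintype.mem_piFinset.1 hu, rfl⟩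
    rw [Finset.card_image_of_injective _ (hinj u hu), Finset.card_univ, Fintype.card_fin]
  · intro u hu v hv huv
    have hu' := Fintype.mem_piFinset.1 (Finset.mem_filter.1 hu).1
    have hv' := Fintype.mem_piFinset.1 (Finset.mem_filter.1 hv).1
    funext i
    have : u i ∈ Finset.univ.image v := by
      rw [← show Finset.univ.image u = Finset.univ.image v from huv]
      exact Finset.mem_image_of_mem u (Finset.mem_univ i)
    obtain ⟨j, -, hj⟩ := Finset.mem_image.1 this
    by_cases hij : i = j
    · rw [← hj, hij]
    · exact absurd (hj ▸ hv' j) (Finset.disjoint_left.1 (hU i j hij) (hu' i))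
  · intro σ hσ
    obtain ⟨hX, -, u, hu, hσu⟩ := (Finset.mem_filter.1 hσ).2
    exact ⟨u, Finset.mem_filter.2 ⟨Fintype.mem_piFinset.2 hu, hσu ▸ hX⟩, hσu.symm⟩

theorem setWeight_eq_flagSum {U : Finset V} (hU : ∀ u ∈ U, {u} ∈ X) :
    setWeight m U = flagSum (X.faceWeight m) [ind U] ∅ := by
  rw [flagSum_cons, setWeight, ← Finset.univ_inter U, ← Finset.sum_ite_mem, Finset.univ_inter]
  refine Finset.sum_congr rfl fun u _ => ?_
  rw [if_neg (Finset.notMem_empty u), flagSum_nil, ind]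
  split_ifs with h
  · rw [one_mul, insert_empty_eq, faceWeight_of_isSimplex (Or.inr (hU u h))]
  · rw [zero_mul]

theorem setWeight_vertexFinset (hm : X.IsWeight n m) (hS : X.IsPartite n S) :
    setWeight m X.vertexFinset = X.faceWeight m ∅ := by
  classical
  rw [← (isPartiteWeight_faceWeight hm hS).sum_insert ∅ (by simp), vertexFinset, setWeight,
    Finset.sum_filter]
  refine Finset.sum_congr rfl fun u _ => ?_
  rw [if_neg (Finset.notMem_empty u), insert_empty_eq]
  split_ifs with h
  · exact (faceWeight_of_isSimplex (Or.inr h)).symm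
  · refine (faceWeight_of_not_isSimplex ?_).symm
    rwa [isSimplex_iff_mem (Finset.singleton_nonempty u)]

end

end PreAbstractSimplicialComplex

/-! ### Passage to the geometric mean and the final estimate. -/

/-- A common bound by the geometric means of all pairs is a bound by the geometric mean. -/
theorem le_mul_prod_rpow_of_pairs {l : ℕ} (hl : 1 ≤ l) {x E : ℝ} (hx : 0 ≤ x) (hE : 0 ≤ E)
    (p : Fin (l + 1) → ℝ) (hp : ∀ i, 0 ≤ p i) (h : ∀ i j, i ≠ j → x ≤ E * √(p i * p j)) :
    x ≤ E * (∏ i, p i) ^ (1 / ((l : ℝ) + 1)) := by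
  have hP : 0 ≤ ∏ i, p i := Finset.prod_nonneg fun i _ => hp i
  -- Addition in `Fin (l + 1)` is cyclic; `l ≥ 1` excludes `1 = 0`. In the product over the pairs
  -- `(i, i + 1)` each `√(p i)` occurs exactly twice.
  have hne : ∀ i : Fin (l + 1), i ≠ i + 1 := by
    intro i hi
    have h1 : (1 : Fin (l + 1)) = 0 := by simpa using hi.symm
    have h2 := congrArg Fin.val h1
    rw [Fin.val_one', Nat.mod_eq_of_lt (by omega)] at h2
    simp at h2
  have h1 : x ^ (l + 1) ≤ (E * (∏ i, p i) ^ (1 / ((l : ℝ) + 1))) ^ (l + 1) := by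
    calc x ^ (l + 1) = ∏ _i : Fin (l + 1), x := by simp
      _ ≤ ∏ i : Fin (l + 1), (E * √(p i * p (i + 1))) :=
          Finset.prod_le_prod (fun _ _ => hx) fun i _ => h i (i + 1) (hne i)
      _ = E ^ (l + 1) * ((∏ i, √(p i)) * ∏ i : Fin (l + 1), √(p (i + 1))) := by
          simp_rw [Real.sqrt_mul (hp _), Finset.prod_mul_distrib]
          simp
      _ = E ^ (l + 1) * ∏ i, p i := by
          have hshift : ∏ i : Fin (l + 1), √(p (i + 1)) = ∏ i, √(p i) :=
            Equiv.prod_comp (Equiv.addRight (1 : Fin (l + 1))) fun i => √(p i)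
          rw [hshift, ← Finset.prod_mul_distrib]
          congr 1
          exact Finset.prod_congr rfl fun i _ => Real.mul_self_sqrt (hp i)
      _ = _ := by
          rw [mul_pow, ← Real.rpow_natCast ((∏ i, p i) ^ (1 / ((l : ℝ) + 1))), ← Real.rpow_mul hP]
          push_cast
          rw [one_div_mul_cancel (by positivity), Real.rpow_one]
  exact le_of_pow_le_pow_left₀ (Nat.succ_ne_zero l) (mul_nonneg hE (Real.rpow_nonneg hP _)) h1

open PreAbstractSimplicialComplex (setWeight)
theorem theorem2p10 (n l : ℕ) (hl : 1 ≤ l) (hln : l ≤ n) :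
    ∃ E : ℝ → ℝ, ContinuousOn E (Set.Ioi (((n : ℝ) - 1) / n)) ∧ Tendsto E (𝓝 1) (𝓝 0) ∧
      ∀ (V : Type*) [Fintype V] [DecidableEq V] (X : PreAbstractSimplicialComplex V)
        (m : Finset V → ℝ) (S : Fin (n + 1) → Finset V) (lam : ℝ),
        X.IsPure n → X.IsWeight n m → X.IsPartite n S → X.LocalSpectralExpansion n m lam →
        ∀ U : Fin (l + 1) → Finset V,
          (∀ i, (U i).Nonempty) →
          (∀ i, U i ⊆ S (Fin.castLE (Nat.succ_le_succ hln) i)) →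
          |X.mixedWeight m U / setWeight m X.vertexFinset
              - 1 / (∏ t ∈ Finset.range (l + 1), ((n : ℝ) + 1 - t))
                * ((∏ i, setWeight m (U i))
                  / ∏ i, setWeight m (S (Fin.castLE (Nat.succ_le_succ hln) i)))|
            ≤ E lam * (⨅ p : {p : Fin (l + 1) × Fin (l + 1) // p.1 < p.2},
                √((setWeight m (U p.1.1) * setWeight m (U p.1.2))
                  / (setWeight m (S (Fin.castLE (Nat.succ_le_succ hln) p.1.1))
                    * setWeight m (S (Fin.castLE (Nat.succ_le_succ hln) p.1.2))))) ∧
          |X.mixedWeight m U / setWeight m X.vertexFinset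
              - 1 / (∏ t ∈ Finset.range (l + 1), ((n : ℝ) + 1 - t))
                * ((∏ i, setWeight m (U i))
                  / ∏ i, setWeight m (S (Fin.castLE (Nat.succ_le_succ hln) i)))|
            ≤ E lam * ((∏ i, setWeight m (U i))
                  / ∏ i, setWeight m (S (Fin.castLE (Nat.succ_le_succ hln) i)))
                ^ (1 / ((l : ℝ) + 1)) := by
  have hn : (1 : ℝ) ≤ n := by exact_mod_cast hl.trans hln
  have hdom : ∀ lam : ℝ, ((n : ℝ) - 1) / n < lam → n * (1 - lam) < 1 := by
    intro lam h
    rw [div_lt_iff₀ (by linarith)] at h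
    linarith
  have hden : ∀ lam : ℝ, ((n : ℝ) - 1) / n < lam → 0 < 1 - ((n : ℝ) - 1) * (1 - lam) := by
    intro lam h
    have := hdom lam h
    rcases le_total (1 - lam) 0 with h' | h'
    · nlinarith
    · nlinarith
  -- One `mixConst` for each of the `l + 1` replacements, evaluated at the correlation constant of
  -- `pairBound_of_hasGap`.
  set E : ℝ → ℝ := fun lam =>
    ((l : ℝ) + 1) * mixConst n (|1 - lam| / (1 - (n - 1) * (1 - lam))) with hE
  have hcont : ContinuousOn E (Set.Ioi (((n : ℝ) - 1) / n)) := by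
    simp only [hE, mixConst]
    have : ContinuousOn (fun lam : ℝ => |1 - lam| / (1 - ((n : ℝ) - 1) * (1 - lam)))
        (Set.Ioi (((n : ℝ) - 1) / n)) :=
      ContinuousOn.div (by fun_prop) (by fun_prop) fun lam h => (hden lam h).ne'
    fun_prop
  refine ⟨E, hcont, ?_, ?_⟩
  · have h1 : (1 : ℝ) ∈ Set.Ioi (((n : ℝ) - 1) / n) := by
      rw [Set.mem_Ioi, div_lt_one (by linarith)]; linarith
    have h2 := (hcont.continuousAt (Ioi_mem_nhds h1)).tendsto
    have h3 : E 1 = 0 := by simp [hE, mixConst]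
    rwa [h3] at h2
  intro V _ _ X m S lam _ hm hS hX U _ hUS
  set c : Fin (l + 1) → Fin (n + 1) := Fin.castLE (Nat.succ_le_succ hln) with hc
  have hcinj : Function.Injective c := Fin.castLE_injective _
  set F := X.faceWeight m with hFdef
  have hF : IsPartiteWeight n S F :=
    PreAbstractSimplicialComplex.isPartiteWeight_faceWeight hm hS
  have h0 : 0 < F ∅ :=
    (PreAbstractSimplicialComplex.faceWeight_pos_iff hm).2 (Or.inl rfl)
  have hlam := hX.lt_lam
  have he : 0 ≤ |1 - lam| / (1 - ((n : ℝ) - 1) * (1 - lam)) :=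
    div_nonneg (abs_nonneg _) (hden lam hlam).le
  have hpair : PairBound S F (|1 - lam| / (1 - ((n : ℝ) - 1) * (1 - lam))) :=
    pairBound_of_hasGap hF
      (PreAbstractSimplicialComplex.edgeConnected_linkEdge hm hS hX.linksConnected) lam
      (hdom lam hlam) (PreAbstractSimplicialComplex.hasGap_linkEdge_of_spectrum hm hS hX)
  -- The estimates need a function on every side. The sides beyond the first `l + 1` receive the
  -- empty set and never enter the list `J`.
  set U' : Fin (n + 1) → Finset V := Function.extend c U fun _ => ∅ with hU'
  have hU'c : ∀ i, U' (c i) = U i := fun i => hcinj.extend_apply U _ i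
  have hU'S : ∀ j, U' j ⊆ S j := by
    intro j
    by_cases h : ∃ i, c i = j
    · obtain ⟨i, rfl⟩ := h
      rw [hU'c]
      exact hUS i
    · rw [hU', Function.extend_apply' _ _ _ h]
      exact Finset.empty_subset _
  have hg : IsSideWeight S fun j => ind (U' j) :=
    ⟨fun j => ind_nonneg _, fun j => ind_le_one _, fun j v hv =>
      ind_of_notMem fun h => hv (hU'S j h)⟩
  have hUw : ∀ i, setWeight m (U i) = flagSum F [ind (U i)] ∅ := fun i =>
    PreAbstractSimplicialComplex.setWeight_eq_flagSum fun u hu => (hS.cover u).2 ⟨_, hUS i hu⟩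
  have hSw : ∀ j, setWeight m (S j) = flagSum F [ind (S j)] ∅ := fun j =>
    PreAbstractSimplicialComplex.setWeight_eq_flagSum fun u hu => (hS.cover u).2 ⟨_, hu⟩
  set p : Fin (l + 1) → ℝ := fun i => setWeight m (U i) / setWeight m (S (c i)) with hp
  have hpmean : ∀ i, sideMean S F (fun j => ind (U' j)) (c i) = p i := by
    intro i
    simp only [sideMean, hp, hUw, hSw, hU'c]
  have hp0 : ∀ i, 0 ≤ p i := fun i => hpmean i ▸ sideMean_nonneg hF hg (c i)
  have hEnn : 0 ≤ E lam := mul_nonneg (by positivity) (mixConst_nonneg n he)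
  set J : List (Fin (n + 1)) := (List.finRange (l + 1)).map c with hJ
  have hJnd : J.Nodup := (List.nodup_finRange _).map hcinj
  have hJlen : J.length = l + 1 := by simp [hJ]
  have hJprod : (J.map (sideMean S F fun j => ind (U' j))).prod = ∏ i, p i := by
    rw [hJ, List.map_map, Fin.prod_univ_def]
    congr 1
    exact List.map_congr_left fun i _ => hpmean i
  have hJmap : J.map (fun j => ind (U' j)) = List.ofFn fun i => ind (U i) := by
    rw [hJ, List.map_map, List.ofFn_eq_map]
    exact List.map_congr_left fun i _ => by simp only [Function.comp_apply, hU'c]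
  have hmixed : X.mixedWeight m U = flagSum F (J.map fun j => ind (U' j)) ∅ := by
    rw [hJmap]
    refine PreAbstractSimplicialComplex.mixedWeight_eq_flagSum U fun i j hij => ?_
    exact (hS.disjoint (c i) (c j) (hcinj.ne hij)).mono (hUS i) (hUS j)
  have hfall : 1 ≤ fallFactor n (l + 1) := one_le_fallFactor (Nat.succ_le_succ hln)
  set x := |X.mixedWeight m U / setWeight m X.vertexFinset
    - 1 / (∏ t ∈ Finset.range (l + 1), ((n : ℝ) + 1 - t))
      * ((∏ i, setWeight m (U i)) / ∏ i, setWeight m (S (c i)))| with hx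
  -- The two quantities differ by the factor `1 / fallFactor n (l + 1)`, which is at most `1` and is
  -- dropped.
  have hxle : x ≤ |flagMean F (fun j => ind (U' j)) J
      - (J.map (sideMean S F fun j => ind (U' j))).prod| := by
    have hxe : x = |1 / fallFactor n (l + 1) * (flagMean F (fun j => ind (U' j)) J
        - (J.map (sideMean S F fun j => ind (U' j))).prod)| := by
      rw [hx, hJprod, hp, Finset.prod_div_distrib,
        PreAbstractSimplicialComplex.setWeight_vertexFinset hm hS, ← hFdef, hmixed, flagMean, hJlen,
        ← fallFactor]
      have hne : fallFactor n (l + 1) ≠ 0 := (zero_lt_one.trans_le hfall).ne'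
      rw [mul_sub, mul_div_assoc, ← mul_assoc, one_div_mul_cancel hne, one_mul]
    rw [hxe, abs_mul, abs_of_nonneg (by positivity)]
    refine mul_le_of_le_one_left (abs_nonneg _) ?_
    exact div_le_one_of_le₀ hfall (zero_le_one.trans hfall)
  have hpairs : ∀ i j, i ≠ j → x ≤ E lam * √(p i * p j) := by
    intro i j hij
    have h := abs_flagMean_sub_prod_le_sqrt hF h0 he hpair hg J hJnd (c i) (c j)
      (List.mem_map_of_mem (List.mem_finRange i)) (List.mem_map_of_mem (List.mem_finRange j))
      (hcinj.ne hij)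
    rw [hpmean, hpmean, hJlen] at h
    refine (hxle.trans h).trans (le_of_eq ?_)
    simp only [hE]
    push_cast
    ring
  constructor
  -- The infimum is only meaningful over a non-empty set of pairs; `l ≥ 1` provides `(0, l)`.
  · have : Nonempty {p : Fin (l + 1) × Fin (l + 1) // p.1 < p.2} :=
      ⟨⟨(0, Fin.last l), by rw [Fin.lt_def]; simp; omega⟩⟩
    rw [Real.mul_iInf_of_nonneg hEnn]
    refine le_ciInf fun q => ?_
    rw [mul_div_mul_comm]
    exact hpairs q.1.1 q.1.2 q.2.ne
  · rw [← Finset.prod_div_distrib]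
    exact le_mul_prod_rpow_of_pairs hl (abs_nonneg _) hEnn p hp0 hpairs
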